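/- Let $n\in\mathbb N$ and let $\mu,\nu$ be measures on $\mathbb R^n$, absolutely continuous with respect to Lebesgue measure, with $\mu(\mathbb R^n)=1$; write $\mu(f)=\int f\,d\mu$. Let $T:[0,1]\to[0,\infty)$ be non-decreasing, positive on $(0,1]$, and such that $x\mapsto T(x)/x$ is non-increasing on $(0,1]$. Let $C_T\in[0,\infty]$ be the optimal (smallest) constant such that for every smooth $f:\mathbb R^n\to\mathbb R$ in $L^2(\mu)$ $$\sup_{p\in(1,2)}\frac{\int f^2\,d\mu-\left(\int|f|^p\,d\mu\right)^{2/p}}{T(2-p)}\le C_T\int|\nabla f|^2\,d\nu .\tag{B}$$ Let $\Phi:\mathbb R\to[0,\infty]$ be a Young function, i.e. $\Phi$ is convex and even, $\Phi(0)=0$, and $\lim_{x\to+\infty}\Phi(x)=+\infty$. Put $\Phi^{-1}(y)=\inf\{x\ge 0:\Phi(x)>y\}$ for $y\ge 0$, let $\mathbb L_\Phi(\mu)$ be the set of measurable $f:\mathbb R^n\to\mathbb R$ with $\int\Phi(\alpha f)\,d\mu<\infty$ for some $\alpha>0$, and let $\|f\|_\Phi=\inf\{\lambda>0:\int\Phi(f/\lambda)\,d\mu\le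 1\}\in[0,\infty]$ be the Luxemburg norm. Let $k\in(0,\infty)$ be such that $\|\mu(f)^2\|_\Phi\le k\,\|f^2\|_\Phi$ for every measurable $f$ with $f^2\in\mathbb L_\Phi(\mu)$. Let $C_\Phi\in[0,\infty]$ be the optimal constant such that for every smooth $f:\mathbb R^n\to\mathbb R$ in $L^1(\mu)$ $$\|(f-\mu(f))^2\|_\Phi\le C_\Phi\int|\nabla f|^2\,d\nu .\tag{O-S}$$ Assume finally that there are constants $c_1,c_2>0$ such that $$c_1\,x\,T\!\left(\frac1{\log(1+x)}\right)\le\Phi^{-1}(x)\le c_2\,x\,T\!\left(\frac1{\log(1+x)}\right)\qquad\text{for all }x>2 .$$ Then the Orlicz–Sobolev inequality (O-S) and the Beckner-type inequality (B) are equivalent, in the sense that one holds with some finite constant if and only if the other does, and $$\frac{c_1}{48(1+k)}\,C_\Phi\le C_T\le 160\,c_2\,C_\Phi .$$ -/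

import Mathlib

open MeasureTheory Set Filter Topology
open scoped ENNReal NNReal ContDiff

noncomputable section

namespace OrliczSobolev

/-- A Young function: a convex even function `Φ : ℝ → [0, ∞]` with `Φ 0 = 0` and
`Φ x → ∞` as `x → ∞`. (Convexity of a `[0, ∞]`-valued function is expressed with weights
in `ℝ≥0`, which act on both `ℝ` and `ℝ≥0∞`.) -/
structure IsYoungFunction (Φ : ℝ → ℝ≥0∞) : Prop where
  convex : ConvexOn ℝ≥0 univ Φ
  even : ∀ x, Φ (-x) = Φ x
  zero : Φ 0 = 0
  tendsto_top : Tendsto Φ atTop (𝓝 ⊤)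

/-- The (right-continuous, generalized) inverse `Φ⁻¹(y) = inf {x ≥ 0 : Φ x > y}` of a Young
function, for `y ≥ 0`. It is the usual inverse of `Φ` restricted to `[0, ∞)` whenever that
inverse exists. -/
def youngInv (Φ : ℝ → ℝ≥0∞) (y : ℝ) : ℝ :=
  sInf {x : ℝ | 0 ≤ x ∧ ENNReal.ofReal y < Φ x}

section Orlicz

variable {X : Type*} [MeasurableSpace X]

/-- Membership in the Orlicz space `L_Φ(μ)`. -/
def MemOrlicz (Φ : ℝ → ℝ≥0∞) (μ : Measure X) (f : X → ℝ) : Prop :=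
  Measurable f ∧ ∃ α : ℝ, 0 < α ∧ ∫⁻ x, Φ (α * f x) ∂μ < ⊤

/-- The Luxemburg norm `inf {r > 0 : ∫ Φ (f / r) dμ ≤ 1}`, with value `∞` when there is no
such `r`. -/
def luxemburgNorm (Φ : ℝ → ℝ≥0∞) (μ : Measure X) (f : X → ℝ) : ℝ≥0∞ :=
  ⨅ (r : ℝ) (_ : 0 < r) (_ : ∫⁻ x, Φ (f x / r) ∂μ ≤ 1), ENNReal.ofReal r

end Orlicz

variable {n : ℕ}

/-- The energy `∫ |∇f|² dν`, with values in `[0, ∞]`. -/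
def energy (ν : Measure (EuclideanSpace ℝ (Fin n))) (f : EuclideanSpace ℝ (Fin n) → ℝ) :
    ℝ≥0∞ :=
  ∫⁻ x, ‖gradient f x‖ₑ ^ 2 ∂ν

/-- The Orlicz–Sobolev inequality with constant `C`:
`‖(f - μ(f))²‖_Φ ≤ C ∫ |∇f|² dν` for every smooth `f` for which the mean `μ(f)` exists. -/
def OrliczSobolevIneq (Φ : ℝ → ℝ≥0∞) (μ ν : Measure (EuclideanSpace ℝ (Fin n)))
    (C : ℝ≥0∞) : Prop :=
  ∀ f : EuclideanSpace ℝ (Fin n) → ℝ, ContDiff ℝ ∞ f → Integrable f μ →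
    luxemburgNorm Φ μ (fun x => (f x - ∫ y, f y ∂μ) ^ 2) ≤ C * energy ν f

/-- The Beckner-type inequality with constant `C`:
`sup_{p ∈ (1,2)} (∫ f² dμ - (∫ |f|^p dμ)^{2/p}) / T (2 - p) ≤ C ∫ |∇f|² dν` for every smooth
square-integrable `f`. The supremum is taken in `[0, ∞]`; the quotients are nonnegative when
`μ` is a probability measure and `T ≥ 0`. -/
def BecknerIneq (T : ℝ → ℝ) (μ ν : Measure (EuclideanSpace ℝ (Fin n)))
    (C : ℝ≥0∞) : Prop :=
  ∀ f : EuclideanSpace ℝ (Fin n) → ℝ, ContDiff ℝ ∞ f → MemLp f 2 μ →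
    (⨆ p ∈ Ioo (1 : ℝ) 2,
      ENNReal.ofReal ((∫ x, f x ^ 2 ∂μ - (∫ x, |f x| ^ p ∂μ) ^ (2 / p)) / T (2 - p)))
      ≤ C * energy ν f

/-- The optimal constant in the Orlicz–Sobolev inequality; `∞` if the inequality holds with no
finite constant. -/
def orliczSobolevConst (Φ : ℝ → ℝ≥0∞) (μ ν : Measure (EuclideanSpace ℝ (Fin n))) : ℝ≥0∞ :=
  sInf {C | OrliczSobolevIneq Φ μ ν C}

/-- The optimal constant in the Beckner-type inequality; `∞` if the inequality holds with no
finite constant. -/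
def becknerConst (T : ℝ → ℝ) (μ ν : Measure (EuclideanSpace ℝ (Fin n))) : ℝ≥0∞ :=
  sInf {C | BecknerIneq T μ ν C}

end OrliczSobolev

end

/-! Both inequalities amount to one family of capacity estimates. Let `m` be a median of `f`, `F = f
- m`, `t > 0`, and let `A = {F > t}` have measure `s`, so that `s ≤ 1/2`. The smooth truncation
`η(F/t)` vanishes where `F ≤ 0` and is at least `9/10` on `A`. Testing either inequality on it gives
`s ≤ const · T(1/log(1+1/s)) · C · energy(η(F/t))`. For (O-S) this uses the bound on `Φ⁻¹(1/s)`
(`OrliczSobolevIneq.level_le`). For (B) it uses the single exponent with `2 - p = 1/log(1+1/s)`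
(`BecknerIneq.level_le`). Maz'ya's inequality (`IsCutoff.lintegral_energy_le`) sums these estimates
against `2t dt`: the truncations of `F` and `-F` together cost at most `4` times the energy of `F`.

From (O-S) to (B), put `ε = 2 - p`. The numerator in (B) is at most the integral of `F²` against the
weight `5ε + min(1, ε log(1+F²/c²))`, where `c² = ∫F²` (`integral_sq_sub_rpow_le`). The weight of a
level set is at most `6 s min(1, ε log(1+1/s))` (`setLIntegral_weight_le`), and the monotonicity of
`T` and of `T(x)/x` turns `T(1/log(1+1/s)) min(1, ε log(1+1/s))` into `T(ε)` (`rate_mul_min_le`).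
The layer cake formula concludes.

From (B) to (O-S), the capacity estimate bounds the Luxemburg norm of the indicator of each level
set. A Minkowski inequality over layers (`luxemburgNorm_sq_le`) then bounds the norm of `F²`, and
the hypothesis on `k` replaces the median by the mean. -/

namespace OrliczSobolev

/-! ### The truncation profile and its scale integral. -/

/-- A smooth non-decreasing profile, `0` on `(-∞, 0]` and constant on `[1, ∞)`, whose derivative is
at most `2 z` at `z ∈ (0, 1)`. -/
structure IsCutoff (η : ℝ → ℝ) : Prop where
  contDiff : ContDiff ℝ ∞ η
  monotone : Monotone η
  eq_zero : ∀ z ≤ 0, η z = 0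
  eq_one : ∀ z, 1 ≤ z → η z = η 1
  le_one : 9 / 10 ≤ η 1
  deriv_sq_le : ∀ z, deriv η z ^ 2 ≤ 4 * z ^ 2
  deriv_eq_zero : ∀ z, z ≤ 0 ∨ 1 ≤ z → deriv η z = 0

theorem exists_isCutoff : ∃ η, IsCutoff η := by
  -- The bump is `1` on `[1/20, 19/20]` and `0` outside `(0, 1)`. The primitive of `2yφ(y)`
  -- therefore rises by at least `(19/20)² - (1/20)² = 9/10`.
  let φ : ContDiffBump (1 / 2 : ℝ) := ⟨9 / 20, 1 / 2, by norm_num, by norm_num⟩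
  have hφc : ContDiff ℝ ∞ (fun y : ℝ => 2 * y * φ y) :=
    (contDiff_const.mul contDiff_id).mul φ.contDiff
  have hcont : Continuous (fun y : ℝ => 2 * y * φ y) := hφc.continuous
  have hout : ∀ z : ℝ, z ≤ 0 ∨ 1 ≤ z → φ z = 0 := by
    intro z hz
    apply φ.zero_of_le_dist
    rw [Real.dist_eq]
    change 1 / 2 ≤ _
    rcases hz with hz | hz
    · rw [abs_of_neg (by linarith)]; linarith
    · rw [abs_of_pos (by linarith)]; linarith
  have hin : ∀ z ∈ Icc (1 / 20 : ℝ) (19 / 20), φ z = 1 := by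
    intro z hz
    apply φ.one_of_mem_closedBall
    rw [Metric.mem_closedBall, Real.dist_eq, abs_le]
    change -(9 / 20 : ℝ) ≤ _ ∧ _ ≤ (9 / 20 : ℝ)
    constructor <;> linarith [hz.1, hz.2]
  let η : ℝ → ℝ := fun z => ∫ y in (0 : ℝ)..z, 2 * y * φ y
  have hd : ∀ z, HasDerivAt η (2 * z * φ z) z := fun z =>
    (hcont.integral_hasStrictDerivAt 0 z).hasDerivAt
  have hderiv : deriv η = fun z => 2 * z * φ z := funext fun z => (hd z).deriv
  have hnn : ∀ z, 0 ≤ 2 * z * φ z := by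
    intro z
    rcases le_total z 0 with h | h
    · simp [hout z (Or.inl h)]
    · exact mul_nonneg (by linarith) φ.nonneg
  have hmono : Monotone η := monotone_of_deriv_nonneg (fun z => (hd z).differentiableAt)
    (fun z => by rw [hderiv]; exact hnn z)
  have hconst : ∀ a b : ℝ, (∀ z ∈ uIcc a b, φ z = 0) → η b = η a := by
    intro a b h
    have h1 : η b - η a = ∫ y in a..b, 2 * y * φ y :=
      intervalIntegral.integral_interval_sub_left (hcont.intervalIntegrable _ _)
        (hcont.intervalIntegrable _ _)
    have h2 : ∫ y in a..b, 2 * y * φ y = ∫ y in a..b, (0 : ℝ) :=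
      intervalIntegral.integral_congr fun z hz => by simp [h z hz]
    rw [h2] at h1
    simp at h1
    linarith
  have h0 : η 0 = 0 := intervalIntegral.integral_same
  refine ⟨η, ⟨?_, hmono, ?_, ?_, ?_, ?_, ?_⟩⟩
  · rw [contDiff_infty_iff_deriv, hderiv]
    exact ⟨fun z => (hd z).differentiableAt, hφc⟩
  · intro z hz
    rw [← h0]
    refine hconst 0 z fun y hy => hout y (Or.inl ?_)
    rw [uIcc_of_ge hz] at hy
    exact hy.2
  · intro z hz
    refine hconst 1 z fun y hy => hout y (Or.inr ?_)
    rw [uIcc_of_le hz] at hy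
    exact hy.1
  · have h1 : η (19 / 20) - η (1 / 20) = ∫ y in (1 / 20 : ℝ)..(19 / 20), 2 * y * φ y :=
      intervalIntegral.integral_interval_sub_left (hcont.intervalIntegrable _ _)
        (hcont.intervalIntegrable _ _)
    have h2 : ∫ y in (1 / 20 : ℝ)..(19 / 20), 2 * y * φ y
        = ∫ y in (1 / 20 : ℝ)..(19 / 20), 2 * y := by
      refine intervalIntegral.integral_congr fun z hz => ?_
      rw [uIcc_of_le (by norm_num)] at hz
      simp [hin z hz]
    rw [h2, intervalIntegral.integral_const_mul, integral_id] at h1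
    have h3 : η (19 / 20) ≤ η 1 := hmono (by norm_num)
    have h4 : η 0 ≤ η (1 / 20) := hmono (by norm_num)
    norm_num at h1
    linarith
  · intro z
    rw [hderiv]
    have h1 : φ z ≤ 1 := φ.le_one
    have h2 : 0 ≤ φ z := φ.nonneg
    have h3 : φ z ^ 2 ≤ 1 := by nlinarith
    change (2 * z * φ z) ^ 2 ≤ _
    nlinarith [sq_nonneg z]
  · intro z hz
    rw [hderiv]
    simp [hout z hz]

theorem IsCutoff.nonneg {η : ℝ → ℝ} (hη : IsCutoff η) (z : ℝ) : 0 ≤ η z := by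
  rcases le_total z 0 with h | h
  · rw [hη.eq_zero z h]
  · rw [← hη.eq_zero 0 le_rfl]; exact hη.monotone h

theorem IsCutoff.le {η : ℝ → ℝ} (hη : IsCutoff η) (z : ℝ) : η z ≤ η 1 := by
  rcases le_total z 1 with h | h
  · exact hη.monotone h
  · rw [hη.eq_one z h]

theorem lintegral_Ioi_inv_cube {a : ℝ} (ha : 0 < a) :
    ∫⁻ t in Ioi a, ENNReal.ofReal (8 * a ^ 2 * t ^ (-3 : ℝ)) = 4 := by
  rw [← ofReal_integral_eq_lintegral_ofReal]
  · rw [integral_const_mul, integral_Ioi_rpow_of_lt (by norm_num) ha]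
    have h : a ^ ((-3 : ℝ) + 1) = (a ^ 2)⁻¹ := by
      rw [← Real.rpow_natCast a 2, ← Real.rpow_neg ha.le]; norm_num
    have : 8 * a ^ 2 * (-a ^ ((-3 : ℝ) + 1) / (-3 + 1)) = 4 := by
      rw [h]; field_simp; norm_num
    rw [this]; norm_num
  · exact (integrableOn_Ioi_rpow_of_lt (by norm_num) ha).const_mul _
  · filter_upwards [ae_restrict_mem measurableSet_Ioi] with t ht
    have : 0 < t := ha.trans ht
    positivity

/-- The bound does not depend on `y`, by scale invariance. Only the sign making the argument
positive contributes, and only for `t > |y|`; there `η'(z)² ≤ 4z²` bounds the integrand by `8y²/t³`,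
whose integral over `(|y|, ∞)` is `4`. -/
theorem IsCutoff.lintegral_scale_le {η : ℝ → ℝ} (hη : IsCutoff η) (y : ℝ) :
    ∫⁻ t in Ioi (0 : ℝ), ENNReal.ofReal (2 * t) *
      (ENNReal.ofReal ((deriv η (y / t) / t) ^ 2) +
        ENNReal.ofReal ((deriv η (-y / t) / t) ^ 2)) ≤ 4 := by
  rcases eq_or_ne y 0 with rfl | hy
  · simp [hη.deriv_eq_zero 0 (Or.inl le_rfl)]
  have ha : 0 < |y| := abs_pos.mpr hy
  have hsq : ∀ t > 0, ∀ z : ℝ, z ^ 2 = y ^ 2 → (deriv η (z / t) / t) ^ 2 ≤ 4 * y ^ 2 / t ^ 4 := by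
    intro t ht z hz
    have := hη.deriv_sq_le (z / t)
    rw [div_pow, div_le_iff₀ (by positivity)]
    refine this.trans (le_of_eq ?_)
    rw [div_pow, hz]; field_simp
  have key : ∀ t ∈ Ioi (0 : ℝ), ENNReal.ofReal (2 * t) *
      (ENNReal.ofReal ((deriv η (y / t) / t) ^ 2) +
        ENNReal.ofReal ((deriv η (-y / t) / t) ^ 2)) ≤
      (Ioi |y|).indicator (fun t => ENNReal.ofReal (8 * |y| ^ 2 * t ^ (-3 : ℝ))) t := by
    intro t ht
    have ht0 : 0 < t := ht
    rw [← ENNReal.ofReal_add (sq_nonneg _) (sq_nonneg _), ← ENNReal.ofReal_mul (by positivity)]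
    by_cases hta : t ∈ Ioi |y|
    · rw [indicator_of_mem hta]
      apply ENNReal.ofReal_le_ofReal
      have hsum : (deriv η (y / t) / t) ^ 2 + (deriv η (-y / t) / t) ^ 2 ≤ 4 * y ^ 2 / t ^ 4 := by
        rcases le_total y 0 with h | h
        · rw [hη.deriv_eq_zero (y / t) (Or.inl (div_nonpos_of_nonpos_of_nonneg h ht0.le))]
          have := hsq t ht0 (-y) (by ring)
          simpa using this
        · rw [hη.deriv_eq_zero (-y / t)
            (Or.inl (div_nonpos_of_nonpos_of_nonneg (by linarith) ht0.le))]
          have := hsq t ht0 y rfl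
          simpa using this
      have h3 : t ^ (-3 : ℝ) = (t ^ 3)⁻¹ := by
        rw [Real.rpow_neg ht0.le]; norm_cast
      rw [h3, sq_abs]
      calc _ ≤ 2 * t * (4 * y ^ 2 / t ^ 4) := by gcongr
        _ = _ := by field_simp; norm_num
    · rw [indicator_of_notMem hta]
      have hta' : t ≤ |y| := not_lt.mp hta
      have hz : ∀ z : ℝ, |z| = |y| → deriv η (z / t) = 0 := by
        intro z hz
        apply hη.deriv_eq_zero
        rcases le_total z 0 with h | h
        · exact Or.inl (div_nonpos_of_nonpos_of_nonneg h ht0.le)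
        · right
          rw [le_div_iff₀ ht0, one_mul, ← abs_of_nonneg h, hz]; exact hta'
      rw [hz y rfl, hz (-y) (abs_neg y)]
      simp
  calc _ ≤ ∫⁻ t in Ioi (0 : ℝ),
        (Ioi |y|).indicator (fun t => ENNReal.ofReal (8 * |y| ^ 2 * t ^ (-3 : ℝ))) t :=
        setLIntegral_mono' measurableSet_Ioi key
    _ ≤ ∫⁻ t, (Ioi |y|).indicator (fun t => ENNReal.ofReal (8 * |y| ^ 2 * t ^ (-3 : ℝ))) t :=
        setLIntegral_le_lintegral _ _
    _ = 4 := by rw [lintegral_indicator measurableSet_Ioi, lintegral_Ioi_inv_cube ha]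

/-! ### Energies of truncations and Maz'ya's inequality. -/

section Energy

variable {n : ℕ} {ν : Measure (EuclideanSpace ℝ (Fin n))} {F : EuclideanSpace ℝ (Fin n) → ℝ}

theorem enorm_gradient (f : EuclideanSpace ℝ (Fin n) → ℝ) (x : EuclideanSpace ℝ (Fin n)) :
    ‖gradient f x‖ₑ = ‖fderiv ℝ f x‖ₑ := by
  unfold gradient
  exact (InnerProductSpace.toDual ℝ (EuclideanSpace ℝ (Fin n))).symm.enorm_map _

theorem enorm_gradient_comp {η : ℝ → ℝ} (hη : Differentiable ℝ η) (hF : Differentiable ℝ F)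
    (x : EuclideanSpace ℝ (Fin n)) :
    ‖gradient (fun x => η (F x)) x‖ₑ ^ 2 =
      ENNReal.ofReal (deriv η (F x) ^ 2) * ‖gradient F x‖ₑ ^ 2 := by
  have h : fderiv ℝ (fun x => η (F x)) x = deriv η (F x) • fderiv ℝ F x :=
    ((hη (F x)).hasDerivAt.comp_hasFDerivAt x (hF x).hasFDerivAt).fderiv
  rw [enorm_gradient, enorm_gradient, h, enorm_smul, mul_pow, ← sq_abs, ENNReal.ofReal_pow
    (abs_nonneg _), Real.enorm_eq_ofReal_abs]

theorem measurable_enorm_gradient_sq (hF : ContDiff ℝ ∞ F) :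
    Measurable fun x => ‖gradient F x‖ₑ ^ 2 := by
  simp_rw [enorm_gradient]
  have : Continuous (fderiv ℝ F) := hF.continuous_fderiv (by simp)
  exact (this.enorm.measurable).pow_const _

theorem IsCutoff.energy_comp {η : ℝ → ℝ} (hη : IsCutoff η) (hF : ContDiff ℝ ∞ F) (t : ℝ) :
    energy ν (fun x => η (F x / t)) =
      ∫⁻ x, ENNReal.ofReal ((deriv η (F x / t) / t) ^ 2) * ‖gradient F x‖ₑ ^ 2 ∂ν := by
  unfold energy
  congr 1
  ext x
  have hd : ∀ z : ℝ, HasDerivAt (fun z => η (z / t)) (deriv η (z / t) * (1 / t)) z := fun z =>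
    ((hη.contDiff.differentiable (by simp)) (z / t)).hasDerivAt.comp z
      ((hasDerivAt_id z).div_const t)
  have := enorm_gradient_comp (F := F) (η := fun z => η (z / t))
    (fun z => (hd z).differentiableAt) (hF.differentiable (by simp)) x
  rw [this, (hd _).deriv, mul_one_div]

theorem energy_sub_const (f : EuclideanSpace ℝ (Fin n) → ℝ) (m : ℝ) :
    energy ν (fun x => f x - m) = energy ν f := by
  unfold energy
  simp_rw [enorm_gradient, fderiv_sub_const]

theorem energy_neg (f : EuclideanSpace ℝ (Fin n) → ℝ) :
    energy ν (fun x => -f x) = energy ν f := by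
  unfold energy
  simp_rw [enorm_gradient, fderiv_fun_neg, enorm_neg]

theorem measurable_cutoff_slice {η : ℝ → ℝ} (hη : IsCutoff η) (hF : ContDiff ℝ ∞ F) (t : ℝ) :
    Measurable fun x => ENNReal.ofReal ((deriv η (F x / t) / t) ^ 2) := by
  have h1 : Continuous (deriv η) := hη.contDiff.continuous_deriv (by simp)
  have h2 : Continuous F := hF.continuous
  exact (((h1.comp (h2.div_const t)).div_const t).pow 2).measurable.ennreal_ofReal

/-- `ν` need not be σ-finite, but `|∇F|² dν` is a finite measure as soon as the energy of `F` is
finite. Rewriting with it makes Tonelli's theorem and measurability in `t` available. -/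
theorem IsCutoff.energy_comp_eq_withDensity {η : ℝ → ℝ} (hη : IsCutoff η) (hF : ContDiff ℝ ∞ F)
    (t : ℝ) :
    energy ν (fun x => η (F x / t)) =
      ∫⁻ x, ENNReal.ofReal ((deriv η (F x / t) / t) ^ 2)
        ∂(ν.withDensity fun x => ‖gradient F x‖ₑ ^ 2) := by
  rw [hη.energy_comp hF, lintegral_withDensity_eq_lintegral_mul _ (measurable_enorm_gradient_sq hF)]
  · congr 1; ext x; simp [mul_comm]
  · exact measurable_cutoff_slice hη hF t

theorem measurable_cutoff_kernel {η : ℝ → ℝ} (hη : IsCutoff η) (hF : ContDiff ℝ ∞ F) :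
    Measurable fun q : ℝ × EuclideanSpace ℝ (Fin n) =>
      ENNReal.ofReal ((deriv η (F q.2 / q.1) / q.1) ^ 2) := by
  have h1 : Measurable (deriv η) := (hη.contDiff.continuous_deriv (by simp)).measurable
  have h2 : Measurable F := hF.continuous.measurable
  exact (((h1.comp ((h2.comp measurable_snd).div measurable_fst)).div
    measurable_fst).pow_const 2).ennreal_ofReal

theorem IsCutoff.measurable_energy_comp {η : ℝ → ℝ} (hη : IsCutoff η) (hF : ContDiff ℝ ∞ F)
    (hE : energy ν F < ⊤) : Measurable fun t => energy ν (fun x => η (F x / t)) := by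
  simp_rw [hη.energy_comp_eq_withDensity hF]
  have : IsFiniteMeasure (ν.withDensity fun x => ‖gradient F x‖ₑ ^ 2) :=
    isFiniteMeasure_withDensity hE.ne
  exact (measurable_cutoff_kernel hη hF).lintegral_prod_right'

/-- Maz'ya's truncation inequality. -/
theorem IsCutoff.lintegral_energy_le {η : ℝ → ℝ} (hη : IsCutoff η) (hF : ContDiff ℝ ∞ F)
    (hE : energy ν F < ⊤) :
    ∫⁻ t in Ioi (0 : ℝ), ENNReal.ofReal (2 * t) * (energy ν (fun x => η (F x / t)) +
      energy ν (fun x => η (-F x / t))) ≤ 4 * energy ν F := by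
  obtain ⟨ρ, hρ⟩ : ∃ ρ, ρ = ν.withDensity fun x => ‖gradient F x‖ₑ ^ 2 := ⟨_, rfl⟩
  have : IsFiniteMeasure ρ := hρ ▸ isFiniteMeasure_withDensity hE.ne
  have hneg : (fun x => ‖gradient (fun x => -F x) x‖ₑ ^ 2) = fun x => ‖gradient F x‖ₑ ^ 2 := by
    ext x; simp_rw [enorm_gradient, fderiv_fun_neg, enorm_neg]
  have hF' : ContDiff ℝ ∞ fun x => -F x := hF.neg
  have hm1 := measurable_cutoff_kernel hη hF
  have hm2 := measurable_cutoff_kernel hη hF'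
  have hm : Measurable fun q : ℝ × EuclideanSpace ℝ (Fin n) =>
      ENNReal.ofReal ((deriv η (F q.2 / q.1) / q.1) ^ 2) +
        ENNReal.ofReal ((deriv η (-F q.2 / q.1) / q.1) ^ 2) := hm1.add hm2
  have hms : ∀ t : ℝ, Measurable fun x => ENNReal.ofReal ((deriv η (F x / t) / t) ^ 2) :=
    fun t => measurable_cutoff_slice hη hF t
  have hms' : ∀ t : ℝ, Measurable fun x => ENNReal.ofReal ((deriv η (F x / t) / t) ^ 2) +
      ENNReal.ofReal ((deriv η (-F x / t) / t) ^ 2) := fun t =>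
    (hms t).add (measurable_cutoff_slice hη hF' t)
  have h1 : ∀ t, ENNReal.ofReal (2 * t) * (energy ν (fun x => η (F x / t)) +
      energy ν (fun x => η (-F x / t))) = ∫⁻ x, ENNReal.ofReal (2 * t) *
      (ENNReal.ofReal ((deriv η (F x / t) / t) ^ 2) +
        ENNReal.ofReal ((deriv η (-F x / t) / t) ^ 2)) ∂ρ := by
    intro t
    rw [lintegral_const_mul _ (hms' t), lintegral_add_left (hms t),
      hη.energy_comp_eq_withDensity hF, hη.energy_comp_eq_withDensity hF', hneg, ← hρ]
  have h2 : ρ univ = energy ν F := by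
    rw [hρ, withDensity_apply _ MeasurableSet.univ, Measure.restrict_univ]
    rfl
  have hmk : AEMeasurable (Function.uncurry fun (t : ℝ) x => ENNReal.ofReal (2 * t) *
      (ENNReal.ofReal ((deriv η (F x / t) / t) ^ 2) +
        ENNReal.ofReal ((deriv η (-F x / t) / t) ^ 2)))
      ((volume.restrict (Ioi (0 : ℝ))).prod ρ) :=
    (((measurable_fst.const_mul 2).ennreal_ofReal).mul hm).aemeasurable
  calc _ = ∫⁻ t in Ioi (0 : ℝ), ∫⁻ x, ENNReal.ofReal (2 * t) *
      (ENNReal.ofReal ((deriv η (F x / t) / t) ^ 2) +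
        ENNReal.ofReal ((deriv η (-F x / t) / t) ^ 2)) ∂ρ := lintegral_congr h1
    _ = ∫⁻ x, (∫⁻ t in Ioi (0 : ℝ), ENNReal.ofReal (2 * t) *
      (ENNReal.ofReal ((deriv η (F x / t) / t) ^ 2) +
        ENNReal.ofReal ((deriv η (-F x / t) / t) ^ 2))) ∂ρ := lintegral_lintegral_swap hmk
    _ ≤ ∫⁻ _, 4 ∂ρ := lintegral_mono fun x => hη.lintegral_scale_le (F x)
    _ = 4 * energy ν F := by rw [lintegral_const, h2]

end Energy

/-! ### Existence of a median. -/

theorem exists_median {X : Type*} [MeasurableSpace X] {μ : Measure X} [IsProbabilityMeasure μ]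
    {f : X → ℝ} (hf : Measurable f) :
    ∃ m : ℝ, μ {x | m < f x} ≤ 1 / 2 ∧ μ {x | f x < m} ≤ 1 / 2 := by
  have hhalf : (1 / 2 : ℝ≥0∞) < 1 := ENNReal.half_lt_self (by simp) (by simp)
  -- The median is `sSup S`. Both strict half-lines at it are increasing unions over `u k ↓ 0` of
  -- sets of measure at most `1/2`, so an atom at the median does no harm.
  set S : Set ℝ := {t | μ {x | f x < t} ≤ 1 / 2} with hS
  have hlow : ∀ s t : ℝ, s ≤ t → t ∈ S → s ∈ S := fun s t hst ht =>
    (measure_mono fun x (hx : f x < s) => hx.trans_le hst).trans ht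
  have hne : S.Nonempty := by
    have h := tendsto_measure_iInter_atTop (μ := μ) (s := fun k : ℕ => {x | f x < -(k : ℝ)})
      (fun k => (measurableSet_lt hf measurable_const).nullMeasurableSet)
      (fun i j hij x (hx : f x < _) => show f x < _ from hx.trans_le
        (neg_le_neg (Nat.cast_le.mpr hij))) ⟨0, measure_ne_top _ _⟩
    have he : ⋂ k : ℕ, {x | f x < -(k : ℝ)} = ∅ := by
      ext x
      simp only [mem_iInter, mem_ofPred_eq, mem_empty_iff_false, iff_false, not_forall, not_lt]
      obtain ⟨k, hk⟩ := exists_nat_ge (-f x)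
      exact ⟨k, by linarith⟩
    rw [he, measure_empty] at h
    obtain ⟨k, hk⟩ := ((tendsto_order.1 h).2 (1 / 2) (by simp)).exists
    exact ⟨_, hk.le⟩
  have hbdd : BddAbove S := by
    have h := tendsto_measure_iUnion_atTop (μ := μ) (s := fun k : ℕ => {x | f x < (k : ℝ)})
      (fun i j hij x (hx : f x < _) => show f x < _ from hx.trans_le (Nat.cast_le.mpr hij))
    have he : ⋃ k : ℕ, {x | f x < (k : ℝ)} = univ := by
      ext x
      simp only [mem_iUnion, mem_ofPred_eq, mem_univ, iff_true]
      exact exists_nat_gt (f x)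
    rw [he, measure_univ] at h
    obtain ⟨k, hk⟩ := ((tendsto_order.1 h).1 (1 / 2) hhalf).exists
    refine ⟨k, fun t ht => ?_⟩
    by_contra! hlt
    exact absurd (hlow _ _ hlt.le ht) (not_le.mpr hk)
  obtain ⟨u, hu, hu0, hulim⟩ := exists_seq_strictAnti_tendsto (0 : ℝ)
  refine ⟨sSup S, ?_, ?_⟩
  · have he : {x | sSup S < f x} = ⋃ k : ℕ, {x | sSup S + u k ≤ f x} := by
      ext x
      simp only [mem_iUnion, mem_ofPred_eq]
      constructor
      · intro hx
        obtain ⟨k, hk⟩ := ((tendsto_order.1 hulim).2 (f x - sSup S) (by linarith)).exists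
        exact ⟨k, by linarith⟩
      · rintro ⟨k, hk⟩
        linarith [hu0 k]
    have hmono : Monotone fun k : ℕ => {x | sSup S + u k ≤ f x} := fun i j hij x hx => by
      have h1 : sSup S + u i ≤ f x := hx
      have h2 : u j ≤ u i := hu.antitone hij
      exact (by linarith : sSup S + u j ≤ f x)
    rw [he]
    refine le_of_tendsto' (tendsto_measure_iUnion_atTop hmono) fun k => ?_
    have hnot : sSup S + u k ∉ S := fun h => by linarith [le_csSup hbdd h, hu0 k]
    have hlt : 1 / 2 < μ {x | f x < sSup S + u k} := not_le.mp hnot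
    have hc : {x | sSup S + u k ≤ f x} = {x | f x < sSup S + u k}ᶜ := by
      ext x; simp
    change μ {x | sSup S + u k ≤ f x} ≤ 1 / 2
    rw [hc, prob_compl_eq_one_sub (measurableSet_lt hf measurable_const)]
    calc 1 - μ {x | f x < sSup S + u k} ≤ 1 - 1 / 2 := tsub_le_tsub_left hlt.le _
      _ = 1 / 2 := by rw [one_div, ENNReal.one_sub_inv_two]
  · have he : {x | f x < sSup S} = ⋃ k : ℕ, {x | f x < sSup S - u k} := by
      ext x
      simp only [mem_iUnion, mem_ofPred_eq]
      constructor
      · intro hx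
        obtain ⟨k, hk⟩ := ((tendsto_order.1 hulim).2 (sSup S - f x) (by linarith)).exists
        exact ⟨k, by linarith⟩
      · rintro ⟨k, hk⟩
        linarith [hu0 k]
    have hmono : Monotone fun k : ℕ => {x | f x < sSup S - u k} := fun i j hij x hx => by
      have h1 : f x < sSup S - u i := hx
      have h2 : u j ≤ u i := hu.antitone hij
      exact (by linarith : f x < sSup S - u j)
    rw [he]
    refine le_of_tendsto' (tendsto_measure_iUnion_atTop hmono) fun k => ?_
    obtain ⟨t, ht, hlt⟩ := exists_lt_of_lt_csSup hne (sub_lt_self (sSup S) (hu0 k))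
    exact hlow _ _ hlt.le ht

/-! ### Young functions, their generalized inverse, and Jensen's inequality. -/

section Young

variable {Φ : ℝ → ℝ≥0∞}

theorem IsYoungFunction.combo_le (hΦ : IsYoungFunction Φ) {a b : ℝ} (ha : 0 ≤ a) (hb : 0 ≤ b)
    (hab : a + b = 1) (x y : ℝ) :
    Φ (a * x + b * y) ≤ ENNReal.ofReal a * Φ x + ENNReal.ofReal b * Φ y := by
  have h := hΦ.convex.2 (mem_univ x) (mem_univ y) (zero_le (a := a.toNNReal))
    (zero_le (a := b.toNNReal))
    (by rw [← Real.toNNReal_add ha hb, hab, Real.toNNReal_one])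
  simpa [NNReal.smul_def, ENNReal.smul_def, Real.coe_toNNReal _ ha, Real.coe_toNNReal _ hb,
    ENNReal.ofReal] using h

theorem IsYoungFunction.mono (hΦ : IsYoungFunction Φ) {x y : ℝ} (hx : 0 ≤ x) (hxy : x ≤ y) :
    Φ x ≤ Φ y := by
  rcases hx.eq_or_lt with rfl | hx0
  · rw [hΦ.zero]; exact zero_le
  have hy : 0 < y := hx0.trans_le hxy
  have h := hΦ.combo_le (a := x / y) (b := 1 - x / y) (by positivity)
    (by rw [sub_nonneg, div_le_one hy]; exact hxy) (by ring) y 0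
  rw [mul_zero, add_zero, div_mul_cancel₀ _ hy.ne', hΦ.zero, mul_zero, add_zero] at h
  refine h.trans ?_
  calc ENNReal.ofReal (x / y) * Φ y ≤ 1 * Φ y := by
        gcongr
        rw [ENNReal.ofReal_le_one, div_le_one hy]; exact hxy
    _ = Φ y := one_mul _

theorem IsYoungFunction.abs (hΦ : IsYoungFunction Φ) (x : ℝ) : Φ |x| = Φ x := by
  rcases abs_choice x with h | h <;> rw [h]
  exact hΦ.even x

theorem IsYoungFunction.mono_abs (hΦ : IsYoungFunction Φ) {x y : ℝ} (hxy : |x| ≤ |y|) :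
    Φ x ≤ Φ y := by
  rw [← hΦ.abs x, ← hΦ.abs y]
  exact hΦ.mono (abs_nonneg x) hxy

theorem IsYoungFunction.measurable (hΦ : IsYoungFunction Φ) : Measurable Φ := by
  have h1 : Monotone fun z => Φ (max z 0) := fun a b hab =>
    hΦ.mono (le_max_right _ _) (max_le_max_right 0 hab)
  have h2 : Φ = (fun z => Φ (max z 0)) ∘ fun z => |z| := by
    ext z
    simp only [Function.comp_apply, max_eq_left (abs_nonneg z), hΦ.abs]
  rw [h2]
  exact h1.measurable.comp measurable_norm

theorem IsYoungFunction.le_youngInv (hΦ : IsYoungFunction Φ) {z y : ℝ}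
    (h : Φ z ≤ ENNReal.ofReal y) : z ≤ youngInv Φ y := by
  refine le_csInf ?_ fun x hx => ?_
  · obtain ⟨x, hx1, hx2⟩ := ((eventually_ge_atTop (0 : ℝ)).and
      ((tendsto_order.1 hΦ.tendsto_top).1 _ ENNReal.ofReal_lt_top)).exists
    exact ⟨x, hx1, hx2⟩
  · by_contra! hlt
    exact absurd (hx.2.trans_le (hΦ.mono hx.1 hlt.le)) (not_lt.mpr h)

theorem le_ofReal_of_lt_youngInv {z y : ℝ} (hz : 0 ≤ z) (h : z < youngInv Φ y) :
    Φ z ≤ ENNReal.ofReal y := by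
  by_contra! hlt
  have hmem : z ∈ {x : ℝ | 0 ≤ x ∧ ENNReal.ofReal y < Φ x} := ⟨hz, hlt⟩
  exact absurd (csInf_le ⟨0, fun x hx => hx.1⟩ hmem) (not_le.mpr h)

/-- Finiteness of `Φ` matters here: it gives a real convex function on all of `ℝ`, which is
automatically continuous, so the real Jensen inequality applies. -/
theorem IsYoungFunction.map_integral_le (hΦ : IsYoungFunction Φ) (hfin : ∀ z, Φ z < ⊤)
    {Y : Type*} [MeasurableSpace Y] {π : Measure Y} [IsProbabilityMeasure π] {g : Y → ℝ}
    (hg : Integrable g π) : Φ (∫ t, g t ∂π) ≤ ∫⁻ t, Φ (g t) ∂π := by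
  rcases eq_or_ne (∫⁻ t, Φ (g t) ∂π) ⊤ with htop | htop
  · rw [htop]; exact le_top
  have hm : AEMeasurable (fun t => Φ (g t)) π := hΦ.measurable.comp_aemeasurable hg.aemeasurable
  have hconv : ConvexOn ℝ univ fun z => (Φ z).toReal := by
    refine ⟨convex_univ, fun x _ y _ a b ha hb hab => ?_⟩
    have h := hΦ.combo_le ha hb hab x y
    have h1 : ENNReal.ofReal a * Φ x ≠ ⊤ := ENNReal.mul_ne_top (by simp) (hfin x).ne
    have h2 : ENNReal.ofReal b * Φ y ≠ ⊤ := ENNReal.mul_ne_top (by simp) (hfin y).ne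
    have h3 := ENNReal.toReal_mono (ENNReal.add_ne_top.mpr ⟨h1, h2⟩) h
    rw [ENNReal.toReal_add h1 h2, ENNReal.toReal_mul, ENNReal.toReal_mul,
      ENNReal.toReal_ofReal ha, ENNReal.toReal_ofReal hb] at h3
    simpa using h3
  have hint : Integrable ((fun z => (Φ z).toReal) ∘ g) π :=
    integrable_toReal_of_lintegral_ne_top hm htop
  have h := hconv.map_integral_le (hconv.continuousOn isOpen_univ) isClosed_univ
    (Eventually.of_forall fun _ => mem_univ _) hg hint
  rw [integral_toReal hm (Eventually.of_forall fun _ => hfin _)] at h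
  exact (ENNReal.toReal_le_toReal (hfin _).ne htop).mp h

end Young

/-! ### Luxemburg norms: triangle inequality and Minkowski over layers. -/

section Luxemburg

variable {X : Type*} [MeasurableSpace X] {μ : Measure X} {Φ : ℝ → ℝ≥0∞}

theorem luxemburgNorm_le {f : X → ℝ} {r : ℝ} (hr : 0 < r) (h : ∫⁻ x, Φ (f x / r) ∂μ ≤ 1) :
    luxemburgNorm Φ μ f ≤ ENNReal.ofReal r :=
  iInf_le_of_le r (iInf_le_of_le hr (iInf_le_of_le h le_rfl))

/-- The strict inequality avoids asking whether the infimum is attained. Callers pay with an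
arbitrarily small `δ`. -/
theorem lintegral_le_one_of_luxemburgNorm_lt (hΦ : IsYoungFunction Φ) {f : X → ℝ} {r : ℝ}
    (h : luxemburgNorm Φ μ f < ENNReal.ofReal r) : ∫⁻ x, Φ (f x / r) ∂μ ≤ 1 := by
  simp only [luxemburgNorm, iInf_lt_iff] at h
  obtain ⟨q, hq, hq1, hqr⟩ := h
  have hqr' : q < r := (ENNReal.ofReal_lt_ofReal_iff' .. ).mp hqr |>.1
  refine (lintegral_mono fun x => hΦ.mono_abs ?_).trans hq1
  rw [abs_div, abs_div, abs_of_pos hq, abs_of_pos (hq.trans hqr')]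
  gcongr

/-- This is the triangle inequality: for radii `a`, `b` admissible for `g`, `h`, convexity with
weights `a/(a+b)` and `b/(a+b)` makes `α(a+b)` admissible for `f`. It serves with `α = 1` to add
positive and negative parts, and with `α = 2` to recentre a square. -/
theorem luxemburgNorm_le_of_abs_le (hΦ : IsYoungFunction Φ) {f g h : X → ℝ} (hg : Measurable g)
    (hh : Measurable h) {α : ℝ} (hα : 0 < α)
    (hf : ∀ x, |f x| ≤ α * (g x + h x)) :
    luxemburgNorm Φ μ f ≤
      ENNReal.ofReal α * (luxemburgNorm Φ μ g + luxemburgNorm Φ μ h) := by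
  rcases eq_or_ne (luxemburgNorm Φ μ g) ⊤ with htop | hgt
  · rw [htop, top_add, ENNReal.mul_top (by simpa using hα)]; exact le_top
  rcases eq_or_ne (luxemburgNorm Φ μ h) ⊤ with htop | hht
  · rw [htop, add_top, ENNReal.mul_top (by simpa using hα)]; exact le_top
  have key : ∀ δ : ℝ, 0 < δ → luxemburgNorm Φ μ f ≤ ENNReal.ofReal
      (α * ((luxemburgNorm Φ μ g).toReal + (luxemburgNorm Φ μ h).toReal + 2 * δ)) := by
    intro δ hδ
    set a := (luxemburgNorm Φ μ g).toReal + δ with ha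
    set b := (luxemburgNorm Φ μ h).toReal + δ with hb
    have ha0 : 0 < a := by positivity
    have hb0 : 0 < b := by positivity
    have h1 : ∫⁻ x, Φ (g x / a) ∂μ ≤ 1 := lintegral_le_one_of_luxemburgNorm_lt hΦ <| by
      rw [ENNReal.lt_ofReal_iff_toReal_lt hgt]; linarith
    have h2 : ∫⁻ x, Φ (h x / b) ∂μ ≤ 1 := lintegral_le_one_of_luxemburgNorm_lt hΦ <| by
      rw [ENNReal.lt_ofReal_iff_toReal_lt hht]; linarith
    have hs : (luxemburgNorm Φ μ g).toReal + (luxemburgNorm Φ μ h).toReal + 2 * δ = a + b := by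
      rw [ha, hb]; ring
    rw [hs]
    refine luxemburgNorm_le (by positivity) ?_
    have hsum : ENNReal.ofReal (a / (a + b)) + ENNReal.ofReal (b / (a + b)) = 1 := by
      rw [← ENNReal.ofReal_add (by positivity) (by positivity), ← add_div,
        div_self (by positivity), ENNReal.ofReal_one]
    calc ∫⁻ x, Φ (f x / (α * (a + b))) ∂μ
        ≤ ∫⁻ x, (ENNReal.ofReal (a / (a + b)) * Φ (g x / a) +
            ENNReal.ofReal (b / (a + b)) * Φ (h x / b)) ∂μ := by
          refine lintegral_mono fun x => ?_
          refine le_trans ?_ (hΦ.combo_le (a := a / (a + b)) (b := b / (a + b)) (by positivity)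
            (by positivity) (by rw [← add_div, div_self (by positivity)]) (g x / a) (h x / b))
          apply hΦ.mono_abs
          have h3 : a / (a + b) * (g x / a) + b / (a + b) * (h x / b)
              = (g x + h x) / (a + b) := by field_simp
          have h4 : 0 ≤ g x + h x := nonneg_of_mul_nonneg_right ((abs_nonneg _).trans (hf x)) hα
          rw [h3, abs_div, abs_of_pos (by positivity : 0 < α * (a + b)),
            abs_of_nonneg (div_nonneg h4 (by positivity)), div_le_div_iff₀ (by positivity) (by positivity)]
          have := mul_le_mul_of_nonneg_right (hf x) (by positivity : 0 ≤ a + b)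
          linarith
      _ = ENNReal.ofReal (a / (a + b)) * ∫⁻ x, Φ (g x / a) ∂μ +
            ENNReal.ofReal (b / (a + b)) * ∫⁻ x, Φ (h x / b) ∂μ := by
          rw [lintegral_add_left, lintegral_const_mul, lintegral_const_mul]
          · exact hΦ.measurable.comp (hh.div_const b)
          · exact hΦ.measurable.comp (hg.div_const a)
          · exact (hΦ.measurable.comp (hg.div_const a)).const_mul _
      _ ≤ ENNReal.ofReal (a / (a + b)) * 1 + ENNReal.ofReal (b / (a + b)) * 1 := by gcongr
      _ = 1 := by rw [mul_one, mul_one, hsum]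
  have hlim : Tendsto (fun δ : ℝ => ENNReal.ofReal
      (α * ((luxemburgNorm Φ μ g).toReal + (luxemburgNorm Φ μ h).toReal + 2 * δ))) (𝓝[>] 0)
      (𝓝 (ENNReal.ofReal
        (α * ((luxemburgNorm Φ μ g).toReal + (luxemburgNorm Φ μ h).toReal + 2 * 0)))) := by
    apply tendsto_nhdsWithin_of_tendsto_nhds
    exact (ENNReal.continuous_ofReal.comp (by fun_prop)).tendsto 0
  have := ge_of_tendsto hlim (eventually_mem_nhdsWithin.mono fun δ hδ => key δ hδ)
  rwa [mul_zero, add_zero, ENNReal.ofReal_mul hα.le,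
    ENNReal.ofReal_add ENNReal.toReal_nonneg ENNReal.toReal_nonneg, ENNReal.ofReal_toReal hgt,
    ENNReal.ofReal_toReal hht] at this

theorem lintegral_Ioi_two_mul_exp_neg_sq :
    ∫⁻ t in Ioi (0 : ℝ), ENNReal.ofReal (2 * t * Real.exp (-t ^ 2)) = 1 := by
  have hd : ∀ t : ℝ, HasDerivAt (fun t => -Real.exp (-t ^ 2)) (2 * t * Real.exp (-t ^ 2)) t := by
    intro t
    have := (((hasDerivAt_id t).pow 2).neg.exp).neg
    refine this.congr_deriv ?_
    simp
    ring
  have hlim : Tendsto (fun t : ℝ => -Real.exp (-t ^ 2)) atTop (𝓝 0) := by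
    rw [← neg_zero]
    exact (Real.tendsto_exp_atBot.comp
      (tendsto_neg_atTop_atBot.comp (tendsto_pow_atTop two_ne_zero))).neg
  have hpos : ∀ t ∈ Ioi (0 : ℝ), 0 ≤ 2 * t * Real.exp (-t ^ 2) := fun t ht => by
    have : 0 < t := ht
    positivity
  have hi := integrableOn_Ioi_deriv_of_nonneg' (fun t _ => hd t) hpos hlim
  rw [← ofReal_integral_eq_lintegral_ofReal hi
    ((ae_restrict_mem measurableSet_Ioi).mono hpos),
    integral_Ioi_of_hasDerivAt_of_nonneg' (fun t _ => hd t) hpos hlim]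
  simp

/-- Minkowski's inequality for the layers of `v²`: if `w t` bounds the Luxemburg norm of the
indicator of `{v > t}`, then `‖v²‖_Φ ≤ ∫ 2 t w(t) dt`. -/
theorem luxemburgNorm_sq_le [SFinite μ] (hΦ : IsYoungFunction Φ) (hfin : ∀ z, Φ z < ⊤)
    {v : X → ℝ} (hv : Measurable v) (hv0 : ∀ x, 0 ≤ v x) {w : ℝ → ℝ≥0∞} (hw : Measurable w)
    (hlev : ∀ t > 0, ∀ r : ℝ, w t < ENNReal.ofReal r → μ {x | t < v x} * Φ (1 / r) ≤ 1) :
    luxemburgNorm Φ μ (fun x => v x ^ 2) ≤ ∫⁻ t in Ioi (0 : ℝ), ENNReal.ofReal (2 * t) * w t := by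
  set N := ∫⁻ t in Ioi (0 : ℝ), ENNReal.ofReal (2 * t) * w t with hN
  rcases eq_or_ne N ⊤ with htop | htop
  · rw [htop]; exact le_top
  have hwfin : ∀ᵐ t ∂volume.restrict (Ioi (0 : ℝ)), w t < ⊤ := by
    have hm : Measurable fun t : ℝ => ENNReal.ofReal (2 * t) * w t := by fun_prop
    filter_upwards [ae_lt_top hm htop, ae_restrict_mem measurableSet_Ioi] with t ht ht0
    have ht0' : (0 : ℝ) < t := ht0
    by_contra h
    rw [not_lt_top_iff.mp h, ENNReal.mul_top (by simpa using ht0')] at ht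
    exact lt_irrefl _ ht
  have key : ∀ δ : ℝ, 0 < δ → luxemburgNorm Φ μ (fun x => v x ^ 2) ≤
      ENNReal.ofReal (N.toReal + δ) := by
    intro δ hδ
    set M := N.toReal + δ with hM
    have hM0 : 0 < M := by positivity
    refine luxemburgNorm_le hM0 ?_
    -- The perturbation keeps `r` positive and strictly above `w` where `w` is finite, as `hlev`
    -- requires. It adds exactly `δ` to the total `∫ 2t w(t) dt`, so `2t r(t)/M` is a probability
    -- density.
    let r : ℝ → ℝ := fun t => (w t).toReal + δ * Real.exp (-t ^ 2)
    have hr0 : ∀ t, 0 < r t := fun t => by positivity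
    have hrm : Measurable r := by fun_prop
    let d : ℝ → ℝ≥0∞ := fun t => ENNReal.ofReal (2 * t * r t / M)
    have hdm : Measurable d := by fun_prop
    let π : Measure ℝ := (volume.restrict (Ioi (0 : ℝ))).withDensity d
    have hd1 : ∫⁻ t in Ioi (0 : ℝ), d t = 1 := by
      have h1 : ∀ᵐ t ∂volume.restrict (Ioi (0 : ℝ)), d t = (ENNReal.ofReal M)⁻¹ *
          (ENNReal.ofReal (2 * t) * w t +
            ENNReal.ofReal δ * ENNReal.ofReal (2 * t * Real.exp (-t ^ 2))) := by
        filter_upwards [hwfin, ae_restrict_mem measurableSet_Ioi] with t ht ht0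
        have ht0' : (0 : ℝ) < t := ht0
        rw [← ENNReal.ofReal_inv_of_pos hM0, ← ENNReal.ofReal_toReal ht.ne,
          ← ENNReal.ofReal_mul (by positivity), ← ENNReal.ofReal_mul (by positivity),
          ← ENNReal.ofReal_add (by positivity) (by positivity),
          ← ENNReal.ofReal_mul (by positivity)]
        change ENNReal.ofReal (2 * t * r t / M) = _
        congr 1
        simp only [r]
        ring
      rw [lintegral_congr_ae h1, lintegral_const_mul _ (by fun_prop),
        lintegral_add_left (by fun_prop), lintegral_const_mul _ (by fun_prop),
        lintegral_Ioi_two_mul_exp_neg_sq, mul_one, ← hN, ← ENNReal.ofReal_toReal htop,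
        ← ENNReal.ofReal_add ENNReal.toReal_nonneg hδ.le, ← hM]
      exact ENNReal.inv_mul_cancel (by simpa using hM0) ENNReal.ofReal_ne_top
    have hπ : IsProbabilityMeasure π := by
      refine ⟨?_⟩
      rw [withDensity_apply _ MeasurableSet.univ, Measure.restrict_univ, hd1]
    -- The layer cake formula exhibits `v²/M` as the `π`-average of the normalised indicators
    -- `1_{t<v}/r(t)`. Jensen and Tonelli then reduce the claim to one level at a time.
    let g : X → ℝ → ℝ := fun x t => (Iio (v x)).indicator (fun t => 1 / r t) t
    have hgm : Measurable (Function.uncurry g) := by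
      have : Function.uncurry g = {q : X × ℝ | q.2 < v q.1}.indicator fun q => 1 / r q.2 := by
        ext ⟨x, t⟩
        simp [g, indicator]
      rw [this]
      exact (measurable_const.div (hrm.comp measurable_snd)).indicator
        (measurableSet_lt measurable_snd (hv.comp measurable_fst))
    have hgx : ∀ x, Measurable (g x) := fun x =>
      (measurable_const.div hrm).indicator measurableSet_Iio
    have hgnn : ∀ x t, 0 ≤ g x t := fun x t =>
      indicator_nonneg (fun t _ => by have := hr0 t; positivity) t
    have hgl : ∀ x, ∫⁻ t, ENNReal.ofReal (g x t) ∂π = ENNReal.ofReal (v x ^ 2 / M) := by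
      intro x
      have h1 : ∀ t ∈ Ioi (0 : ℝ), (d * fun t => ENNReal.ofReal (g x t)) t =
          (Iio (v x)).indicator (fun t => ENNReal.ofReal (2 * t / M)) t := by
        intro t ht
        have ht0 : (0 : ℝ) < t := ht
        have := hr0 t
        simp only [Pi.mul_apply, d, g]
        by_cases h : t ∈ Iio (v x)
        · rw [indicator_of_mem h, indicator_of_mem h, ← ENNReal.ofReal_mul (by positivity)]
          congr 1
          field_simp
        · rw [indicator_of_notMem h, indicator_of_notMem h, ENNReal.ofReal_zero, mul_zero]
      rw [lintegral_withDensity_eq_lintegral_mul _ hdm (hgx x).ennreal_ofReal,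
        setLIntegral_congr_fun measurableSet_Ioi h1, lintegral_indicator measurableSet_Iio,
        Measure.restrict_restrict measurableSet_Iio, Iio_inter_Ioi,
        Measure.restrict_congr_set Ioo_ae_eq_Ioc, ← ofReal_integral_eq_lintegral_ofReal,
        ← intervalIntegral.integral_of_le (hv0 x), intervalIntegral.integral_div,
        intervalIntegral.integral_const_mul, integral_id]
      · congr 1; ring
      · exact (Continuous.integrableOn_Icc (by fun_prop)).mono_set Ioc_subset_Icc_self
      · filter_upwards [ae_restrict_mem measurableSet_Ioc] with t ht
        have : 0 < t := ht.1
        positivity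
    have hgi : ∀ x, Integrable (g x) π := fun x => by
      refine ⟨(hgx x).aestronglyMeasurable, ?_⟩
      rw [hasFiniteIntegral_iff_ofReal (Eventually.of_forall (hgnn x)), hgl x]
      exact ENNReal.ofReal_lt_top
    have hgint : ∀ x, ∫ t, g x t ∂π = v x ^ 2 / M := fun x => by
      rw [integral_eq_lintegral_of_nonneg_ae (Eventually.of_forall (hgnn x))
        (hgx x).aestronglyMeasurable, hgl x, ENNReal.toReal_ofReal (by positivity)]
    calc ∫⁻ x, Φ (v x ^ 2 / M) ∂μ ≤ ∫⁻ x, (∫⁻ t, Φ (g x t) ∂π) ∂μ := by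
          refine lintegral_mono fun x => ?_
          rw [← hgint x]
          exact hΦ.map_integral_le hfin (hgi x)
      _ = ∫⁻ t, (∫⁻ x, Φ (g x t) ∂μ) ∂π :=
          lintegral_lintegral_swap (hΦ.measurable.comp hgm).aemeasurable
      _ ≤ ∫⁻ _, 1 ∂π := by
          refine lintegral_mono_ae ?_
          have hac : π ≪ volume.restrict (Ioi (0 : ℝ)) := withDensity_absolutelyContinuous _ _
          filter_upwards [hac.ae_le hwfin, hac.ae_le (ae_restrict_mem measurableSet_Ioi)]
            with t ht ht0
          have h1 : ∀ x, Φ (g x t) = {x | t < v x}.indicator (fun _ => Φ (1 / r t)) x := by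
            intro x
            by_cases h : t < v x
            · rw [indicator_of_mem (show x ∈ {x | t < v x} from h)]
              simp only [g]
              rw [indicator_of_mem (show t ∈ Iio (v x) from h)]
            · rw [indicator_of_notMem (show x ∉ {x | t < v x} from h)]
              simp only [g]
              rw [indicator_of_notMem (show t ∉ Iio (v x) from h), hΦ.zero]
          simp_rw [h1]
          rw [lintegral_indicator (measurableSet_lt measurable_const hv), setLIntegral_const,
            mul_comm]
          refine hlev t ht0 (r t) ?_
          rw [ENNReal.lt_ofReal_iff_toReal_lt ht.ne]
          exact lt_add_of_pos_right _ (by positivity)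
      _ = 1 := by simp
  have hlim : Tendsto (fun δ : ℝ => ENNReal.ofReal (N.toReal + δ)) (𝓝[>] 0)
      (𝓝 (ENNReal.ofReal (N.toReal + 0))) := by
    apply tendsto_nhdsWithin_of_tendsto_nhds
    exact (ENNReal.continuous_ofReal.comp (by fun_prop)).tendsto 0
  have := ge_of_tendsto hlim (eventually_mem_nhdsWithin.mono fun δ hδ => key δ hδ)
  rwa [add_zero, ENNReal.ofReal_toReal htop] at this

end Luxemburg

/-! ### Pointwise inequalities for the linearised `p`-variance. -/

section Elementary

/-- The difference of the two sides is monotone on `[0, 1]` and vanishes at `1`. The sign of its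
derivative is the weighted AM-GM inequality `z^(p-1) ≤ (p-1)z + (2-p)`. -/
theorem one_sub_rpow_le {p r : ℝ} (hp1 : 1 < p) (hp2 : p < 2) (hr0 : 0 ≤ r) (hr1 : r ≤ 1) :
    r ^ 2 - 1 - 2 / p * (r ^ p - 1) ≤ (2 - p) * (1 - r) ^ 2 := by
  have hd : ∀ z : ℝ, 0 < z → HasDerivAt
      (fun z : ℝ => 2 / p * z ^ p - z ^ 2 + (2 - p) * (1 - z) ^ 2)
      (2 * (z ^ (p - 1) - ((p - 1) * z + (2 - p)))) z := by
    intro z hz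
    have h1 := (Real.hasDerivAt_rpow_const (p := p) (Or.inl hz.ne')).const_mul (2 / p)
    have h2 := (hasDerivAt_id z).pow 2
    have h3 := (((hasDerivAt_const z (1 : ℝ)).sub (hasDerivAt_id z)).pow 2).const_mul (2 - p)
    refine ((h1.sub h2).add h3).congr_deriv ?_
    simp
    field_simp
    ring
  have hcont : ContinuousOn (fun z : ℝ => 2 / p * z ^ p - z ^ 2 + (2 - p) * (1 - z) ^ 2)
      (Icc 0 1) := by
    have : Continuous fun z : ℝ => z ^ p := Real.continuous_rpow_const (by linarith)
    exact Continuous.continuousOn (by fun_prop)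
  have hanti := antitoneOn_of_deriv_nonpos (convex_Icc (0 : ℝ) 1) hcont
    (fun z hz => by
      rw [interior_Icc] at hz
      exact (hd z hz.1).differentiableAt.differentiableWithinAt)
    (fun z hz => by
      rw [interior_Icc] at hz
      rw [(hd z hz.1).deriv]
      have := Real.geom_mean_le_arith_mean2_weighted (w₁ := p - 1) (w₂ := 2 - p) (p₁ := z)
        (p₂ := 1) (by linarith) (by linarith) hz.1.le (by norm_num) (by ring)
      rw [Real.one_rpow, mul_one, mul_one] at this
      linarith)
  have := hanti ⟨hr0, hr1⟩ ⟨zero_le_one, le_rfl⟩ hr1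
  simp only [Real.one_rpow] at this
  have h2 : 2 / p * (r ^ p - 1) = 2 / p * r ^ p - 2 / p * 1 := by ring
  nlinarith

/-- Bernoulli's inequality `r^p - 1 ≥ p(r - 1)` leaves `r² - 1 - 2(r - 1)`. There is no factor `2 -
p`: this is the branch `1` of the later minimum. -/
theorem sq_sub_rpow_le_sq {p r : ℝ} (hp1 : 1 < p) (hr0 : 0 ≤ r) :
    r ^ 2 - 1 - 2 / p * (r ^ p - 1) ≤ (r - 1) ^ 2 := by
  have h := one_add_mul_self_le_rpow_one_add (s := r - 1) (by linarith) hp1.le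
  rw [add_sub_cancel] at h
  have h2 : 2 * (r - 1) ≤ 2 / p * (r ^ p - 1) := by
    calc 2 * (r - 1) = 2 / p * (p * (r - 1)) := by field_simp
      _ ≤ 2 / p * (r ^ p - 1) := by gcongr; linarith
  nlinarith

/-- Writing `r^p = r² exp(-(2-p) log r)` and using `exp(-x) ≥ 1 - x` extracts the factor `2 - p` at
the price of a logarithm. This is the other branch of the later minimum. -/
theorem sq_sub_rpow_le_log {p r : ℝ} (hp1 : 1 < p) (hp2 : p < 2) (hr : 1 ≤ r) :
    r ^ 2 - 1 - 2 / p * (r ^ p - 1) ≤ (2 - p) * (r - 1) ^ 2 * (3 + 2 * Real.log r) := by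
  have hr0 : 0 < r := by linarith
  have hL0 : 0 ≤ Real.log r := Real.log_nonneg hr
  have hL1 : Real.log r ≤ r - 1 := Real.log_le_sub_one_of_pos hr0
  have h1 : r ^ 2 * (1 - (2 - p) * Real.log r) ≤ r ^ p := by
    have h2 : r ^ p = r ^ 2 * Real.exp (-((2 - p) * Real.log r)) := by
      rw [Real.rpow_def_of_pos hr0, ← Real.exp_log (pow_pos hr0 2), Real.log_pow, ← Real.exp_add]
      congr 1; push_cast; ring
    rw [h2]
    gcongr
    linarith [Real.add_one_le_exp (-((2 - p) * Real.log r))]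
  have h3 : r ^ 2 - 1 - 2 / p * (r ^ p - 1)
      ≤ (2 - p) / p * (2 * r ^ 2 * Real.log r - (r ^ 2 - 1)) := by
    calc r ^ 2 - 1 - 2 / p * (r ^ p - 1)
        ≤ r ^ 2 - 1 - 2 / p * (r ^ 2 * (1 - (2 - p) * Real.log r) - 1) := by gcongr
      _ = _ := by field_simp; ring
  -- With `log r ≤ r - 1`, the right side minus the left is at least `(r-1)(3(r-1) + (r+1) -
  -- 2(2r-1)) = 0`. The constant `3` makes this cancellation exact.
  have h4 : 2 * r ^ 2 * Real.log r - (r ^ 2 - 1) ≤ (r - 1) ^ 2 * (3 + 2 * Real.log r) := by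
    nlinarith [mul_le_mul_of_nonneg_left hL1 (by linarith : 0 ≤ 2 * r - 1)]
  have h5 : 0 ≤ (r - 1) ^ 2 * (3 + 2 * Real.log r) := by positivity
  calc _ ≤ (2 - p) / p * (2 * r ^ 2 * Real.log r - (r ^ 2 - 1)) := h3
    _ ≤ (2 - p) / p * ((r - 1) ^ 2 * (3 + 2 * Real.log r)) := by
        gcongr
    _ ≤ (2 - p) * ((r - 1) ^ 2 * (3 + 2 * Real.log r)) := by
        gcongr
        exact div_le_self (by linarith) hp1.le
    _ = _ := by ring

/-- Pointwise control of the linearised `p`-variance of `m + y` at level `|m| + c`. -/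
theorem linearised_le {p m y c : ℝ} (hp1 : 1 < p) (hp2 : p < 2) (hc : 0 < c) :
    |m + y| ^ 2 - (|m| + c) ^ 2 -
        2 / p * ((|m| + c) ^ 2 * ((|m + y| / (|m| + c)) ^ p - 1)) ≤
      (2 - p) * (3 * y ^ 2 + 2 * c ^ 2) +
        y ^ 2 * min 1 ((2 - p) * Real.log (1 + y ^ 2 / c ^ 2)) := by
  -- Linearising at `|m| + c` removes `m` from the bound. Below this level `e(1-r) ≤ |y| + c`; above
  -- it `e(r-1) ≤ |y| - c` and `r ≤ |y|/c`, so the logarithm involves only `y/c`.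
  set e := |m| + c with he
  have hm : 0 ≤ |m| := abs_nonneg m
  have he0 : 0 < e := by positivity
  have hy : |m + y| ≤ |m| + |y| := abs_add_le m y
  have hy' : |m| - |y| ≤ |m + y| := by
    have := abs_sub_abs_le_abs_sub m (-y)
    rwa [abs_neg, sub_neg_eq_add] at this
  set r := |m + y| / e with hr
  have hr0 : 0 ≤ r := by positivity
  have hre : |m + y| = r * e := by rw [hr]; field_simp
  have hH : |m + y| ^ 2 - e ^ 2 - 2 / p * (e ^ 2 * (r ^ p - 1)) =
      e ^ 2 * (r ^ 2 - 1 - 2 / p * (r ^ p - 1)) := by rw [hre]; ring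
  have hlog0 : 0 ≤ Real.log (1 + y ^ 2 / c ^ 2) := Real.log_nonneg (by
    have : 0 ≤ y ^ 2 / c ^ 2 := by positivity
    linarith)
  have hp0 : 0 < 2 - p := by linarith
  have hg0 : 0 ≤ min 1 ((2 - p) * Real.log (1 + y ^ 2 / c ^ 2)) :=
    le_min zero_le_one (by positivity)
  rw [hH]
  rcases le_total r 1 with h1 | h1
  · have h2 := one_sub_rpow_le hp1 hp2 hr0 h1
    have h3 : (e * (1 - r)) ^ 2 ≤ (|y| + c) ^ 2 := by
      have : e * (1 - r) = e - |m + y| := by rw [hre]; ring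
      rw [this]
      apply pow_le_pow_left₀
      · rw [hre]; nlinarith
      · linarith
    have h4 : (|y| + c) ^ 2 ≤ 2 * y ^ 2 + 2 * c ^ 2 := by
      nlinarith [sq_nonneg (|y| - c), sq_abs y]
    calc e ^ 2 * (r ^ 2 - 1 - 2 / p * (r ^ p - 1)) ≤ e ^ 2 * ((2 - p) * (1 - r) ^ 2) := by gcongr
      _ = (2 - p) * (e * (1 - r)) ^ 2 := by ring
      _ ≤ (2 - p) * (3 * y ^ 2 + 2 * c ^ 2) := by gcongr; nlinarith [sq_nonneg y]
      _ ≤ _ := le_add_of_nonneg_right (by positivity)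
  · have h5 : e * (r - 1) = |m + y| - e := by rw [hre]; ring
    have h6 : e * (r - 1) ≤ |y| - c := by rw [h5]; linarith
    have h60 : 0 ≤ e * (r - 1) := mul_nonneg he0.le (by linarith)
    have h7 : (e * (r - 1)) ^ 2 ≤ y ^ 2 := by
      rw [← sq_abs y]; exact pow_le_pow_left₀ h60 (by linarith) 2
    have h8 : r ≤ |y| / c := by
      rw [le_div_iff₀ hc]
      nlinarith [mul_nonneg hm (by linarith : 0 ≤ r - 1)]
    have h9 : 2 * Real.log r ≤ Real.log (1 + y ^ 2 / c ^ 2) := by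
      have : 2 * Real.log r = Real.log (r ^ 2) := by rw [Real.log_pow]; norm_cast
      rw [this]
      apply Real.log_le_log (by positivity)
      calc r ^ 2 ≤ (|y| / c) ^ 2 := pow_le_pow_left₀ hr0 h8 2
        _ = y ^ 2 / c ^ 2 := by rw [div_pow, sq_abs]
        _ ≤ _ := by linarith
    have hA : e ^ 2 * (r ^ 2 - 1 - 2 / p * (r ^ p - 1)) ≤ y ^ 2 := by
      calc _ ≤ e ^ 2 * (r - 1) ^ 2 := by gcongr; exact sq_sub_rpow_le_sq hp1 hr0
        _ = (e * (r - 1)) ^ 2 := by ring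
        _ ≤ _ := h7
    have hB : e ^ 2 * (r ^ 2 - 1 - 2 / p * (r ^ p - 1)) ≤
        (2 - p) * (3 * y ^ 2) + y ^ 2 * ((2 - p) * Real.log (1 + y ^ 2 / c ^ 2)) := by
      calc _ ≤ e ^ 2 * ((2 - p) * (r - 1) ^ 2 * (3 + 2 * Real.log r)) := by
            gcongr; exact sq_sub_rpow_le_log hp1 hp2 h1
        _ = (2 - p) * (e * (r - 1)) ^ 2 * (3 + 2 * Real.log r) := by ring
        _ ≤ (2 - p) * y ^ 2 * (3 + Real.log (1 + y ^ 2 / c ^ 2)) := by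
            have : 0 ≤ Real.log r := Real.log_nonneg h1
            gcongr
        _ = _ := by ring
    have hpos : 0 ≤ (2 - p) * (3 * y ^ 2) := by positivity
    have hpos2 : 0 ≤ (2 - p) * (2 * c ^ 2) := by positivity
    rcases min_choice 1 ((2 - p) * Real.log (1 + y ^ 2 / c ^ 2)) with h | h <;> rw [h] <;>
      nlinarith

end Elementary

/-! ### Upper bound for the `p`-variance. -/

/-- The lower bound of an `L^p`-norm by its tangent line. -/
theorem tangent_le_rpow {p c Y : ℝ} (hp1 : 1 < p) (hp2 : p < 2) (hc : 0 < c) (hY : 0 ≤ Y) :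
    c ^ 2 + 2 / p * (c ^ 2 * (Y / c ^ p - 1)) ≤ Y ^ (2 / p) := by
  have hcp : 0 < c ^ p := Real.rpow_pos_of_pos hc p
  have h := one_add_mul_self_le_rpow_one_add (s := Y / c ^ p - 1) (p := 2 / p)
    (by have : 0 ≤ Y / c ^ p := by positivity
        linarith) (by rw [le_div_iff₀ (by linarith)]; linarith)
  rw [add_sub_cancel, Real.div_rpow hY hcp.le, ← Real.rpow_mul hc.le,
    mul_div_cancel₀ _ (by linarith : p ≠ 0), Real.rpow_two, le_div_iff₀ (by positivity)] at h
  linarith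

/-- Bound of the `p`-variance by a weighted second moment about any centre `m`. -/
theorem integral_sq_sub_rpow_le {X : Type*} [MeasurableSpace X] {μ : Measure X}
    [IsProbabilityMeasure μ] {f : X → ℝ} (hfm : Measurable f) (hf : MemLp f 2 μ) {p : ℝ}
    (hp1 : 1 < p) (hp2 : p < 2)
    (m : ℝ) {c : ℝ} (hc : 0 < c) (hcsq : c ^ 2 = ∫ x, (f x - m) ^ 2 ∂μ) :
    ∫ x, f x ^ 2 ∂μ - (∫ x, |f x| ^ p ∂μ) ^ (2 / p) ≤
      ∫ x, (f x - m) ^ 2 * (5 * (2 - p) +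
        min 1 ((2 - p) * Real.log (1 + (f x - m) ^ 2 / c ^ 2))) ∂μ := by
  have hF : MemLp (fun x => f x - m) 2 μ := hf.sub (memLp_const m)
  have hi2 : Integrable (fun x => f x ^ 2) μ := hf.integrable_sq
  have hF2 : Integrable (fun x => (f x - m) ^ 2) μ := hF.integrable_sq
  have hip : Integrable (fun x => |f x| ^ p) μ := by
    have h1 : MemLp f (ENNReal.ofReal p) μ := hf.mono_exponent (by
      rw [← ENNReal.ofReal_ofNat]; exact ENNReal.ofReal_le_ofReal hp2.le)
    have h2 := h1.integrable_norm_rpow (by simpa using by linarith) ENNReal.ofReal_ne_top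
    rwa [ENNReal.toReal_ofReal (by linarith)] at h2
  set e := |m| + c with he
  have he0 : 0 < e := by positivity
  have hep : 0 < e ^ p := Real.rpow_pos_of_pos he0 p
  have hgi : Integrable (fun x => (f x - m) ^ 2 *
      min 1 ((2 - p) * Real.log (1 + (f x - m) ^ 2 / c ^ 2))) μ := by
    refine hF2.mono (Measurable.aestronglyMeasurable (by fun_prop)) (Eventually.of_forall ?_)
    intro x
    have h1 : 0 ≤ Real.log (1 + (f x - m) ^ 2 / c ^ 2) := Real.log_nonneg (by
      have : 0 ≤ (f x - m) ^ 2 / c ^ 2 := by positivity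
      linarith)
    have h2 : 0 ≤ min 1 ((2 - p) * Real.log (1 + (f x - m) ^ 2 / c ^ 2)) :=
      le_min zero_le_one (mul_nonneg (by linarith) h1)
    rw [norm_mul, Real.norm_of_nonneg h2]
    exact mul_le_of_le_one_right (norm_nonneg _) (min_le_left _ _)
  have hY : 0 ≤ ∫ x, |f x| ^ p ∂μ := integral_nonneg fun x => by positivity
  have hiL : Integrable (fun x => f x ^ 2 - e ^ 2 -
      2 / p * (e ^ 2 * (|f x| ^ p / e ^ p - 1))) μ :=
    (hi2.sub (integrable_const _)).sub
      ((((hip.div_const _).sub (integrable_const _)).const_mul _).const_mul _)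
  have hint : ∫ x, (f x ^ 2 - e ^ 2 - 2 / p * (e ^ 2 * (|f x| ^ p / e ^ p - 1))) ∂μ =
      ∫ x, f x ^ 2 ∂μ - e ^ 2 - 2 / p * (e ^ 2 * ((∫ x, |f x| ^ p ∂μ) / e ^ p - 1)) := by
    rw [integral_sub, integral_sub hi2 (integrable_const _), integral_const_mul,
      integral_const_mul, integral_sub (hip.div_const _) (integrable_const _), integral_div]
    · simp
    · exact hi2.sub (integrable_const _)
    · exact (((hip.div_const _).sub (integrable_const _)).const_mul _).const_mul _
  have hq : Integrable (fun x => (2 - p) * (3 * (f x - m) ^ 2 + 2 * c ^ 2)) μ :=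
    ((hF2.const_mul _).add (integrable_const _)).const_mul _
  -- Since `c²` is the second moment about `m` and `μ` has mass one, the constant `2c²` integrates
  -- like `2(f - m)²`. This turns `3 + 2` into the weight `5(2 - p)`.
  have hint2 : ∫ x, ((2 - p) * (3 * (f x - m) ^ 2 + 2 * c ^ 2) + (f x - m) ^ 2 *
        min 1 ((2 - p) * Real.log (1 + (f x - m) ^ 2 / c ^ 2))) ∂μ =
      ∫ x, (f x - m) ^ 2 * (5 * (2 - p) +
        min 1 ((2 - p) * Real.log (1 + (f x - m) ^ 2 / c ^ 2))) ∂μ := by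
    have h1 : ∀ x, (f x - m) ^ 2 * (5 * (2 - p) +
        min 1 ((2 - p) * Real.log (1 + (f x - m) ^ 2 / c ^ 2))) =
        5 * (2 - p) * (f x - m) ^ 2 + (f x - m) ^ 2 *
        min 1 ((2 - p) * Real.log (1 + (f x - m) ^ 2 / c ^ 2)) := fun x => by ring
    simp_rw [h1]
    rw [integral_add hq hgi,
      integral_add (hF2.const_mul _) hgi, integral_const_mul, integral_const_mul,
      integral_add (hF2.const_mul _) (integrable_const _), integral_const_mul, ← hcsq]
    simp
    ring
  have hT := tangent_le_rpow hp1 hp2 he0 hY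
  rw [← hint2]
  calc _ ≤ ∫ x, f x ^ 2 ∂μ - e ^ 2 - 2 / p * (e ^ 2 * ((∫ x, |f x| ^ p ∂μ) / e ^ p - 1)) := by
        linarith
    _ = _ := hint.symm
    _ ≤ _ := by
        refine integral_mono hiL (hq.add hgi) fun x => ?_
        have := linearised_le (m := m) (y := f x - m) hp1 hp2 hc
        rw [add_sub_cancel, sq_abs, ← he, Real.div_rpow (abs_nonneg _) he0.le] at this
        exact this

/-! ### The rate `T` and its comparison with the inverse of `Φ`. -/

section Rate

variable {T : ℝ → ℝ}

theorem one_lt_log_one_add {x : ℝ} (hx : 2 ≤ x) : 1 < Real.log (1 + x) := by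
  rw [Real.lt_log_iff_exp_lt (by linarith)]
  linarith [Real.exp_one_lt_d9]

theorem one_div_log_mem {x : ℝ} (hx : 2 ≤ x) : 1 / Real.log (1 + x) ∈ Ioo (0 : ℝ) 1 := by
  have h := one_lt_log_one_add hx
  exact ⟨by positivity, by rw [div_lt_one (by linarith)]; exact h⟩

theorem rate_mul_le (hT_div : AntitoneOn (fun x => T x / x) (Ioc 0 1)) {x y : ℝ} (hx : 0 < x)
    (hxy : x ≤ y) (hy : y ≤ 1) : x * T y ≤ y * T x := by
  have h : T y / y ≤ T x / x := hT_div ⟨hx, hxy.trans hy⟩ ⟨hx.trans_le hxy, hy⟩ hxy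
  rw [div_le_div_iff₀ (hx.trans_le hxy) hx] at h
  linarith

/-- Each assumption on `T` handles one branch of the minimum. If `1/log(1+x) ≤ ε`, monotonicity of
`T` suffices; otherwise `T(x)/x` non-increasing trades the factor `ε log(1+x)` for the passage to `T
ε`. -/
theorem rate_mul_min_le (hT_pos : ∀ x ∈ Ioc (0 : ℝ) 1, 0 < T x)
    (hT_mono : MonotoneOn T (Icc 0 1)) (hT_div : AntitoneOn (fun x => T x / x) (Ioc 0 1))
    {x ε : ℝ} (hx : 2 ≤ x) (hε : ε ∈ Ioo (0 : ℝ) 1) :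
    T (1 / Real.log (1 + x)) * min 1 (ε * Real.log (1 + x)) ≤ T ε := by
  obtain ⟨hl0, hl1⟩ := one_div_log_mem hx
  have hL := one_lt_log_one_add hx
  have hTl := hT_pos _ ⟨hl0, hl1.le⟩
  rcases le_total (1 / Real.log (1 + x)) ε with h | h
  · calc _ ≤ T (1 / Real.log (1 + x)) * 1 := by gcongr; exact min_le_left _ _
      _ ≤ T ε := by rw [mul_one]; exact hT_mono ⟨hl0.le, hl1.le⟩ ⟨hε.1.le, hε.2.le⟩ h
  · have h1 := rate_mul_le hT_div hε.1 h hl1.le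
    calc _ ≤ T (1 / Real.log (1 + x)) * (ε * Real.log (1 + x)) := by
          gcongr; exact min_le_right _ _
      _ = (ε * T (1 / Real.log (1 + x))) * Real.log (1 + x) := by ring
      _ ≤ (1 / Real.log (1 + x) * T ε) * Real.log (1 + x) := by gcongr
      _ = T ε := by field_simp

theorem youngInv_mono {Φ : ℝ → ℝ≥0∞} (hΦ : IsYoungFunction Φ) {x y : ℝ} (hxy : x ≤ y) :
    youngInv Φ x ≤ youngInv Φ y := by
  obtain ⟨z, hz1, hz2⟩ := ((eventually_ge_atTop (0 : ℝ)).and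
      ((tendsto_order.1 hΦ.tendsto_top).1 _ (ENNReal.ofReal_lt_top (r := y)))).exists
  exact csInf_le_csInf ⟨0, fun x hx => hx.1⟩ ⟨z, hz1, hz2⟩ fun z hz =>
    ⟨hz.1, (ENNReal.ofReal_le_ofReal hxy).trans_lt hz.2⟩

/-- Sets of measure exactly `1/2` need the endpoint `x = 2`. The generalized inverse is
right-continuous, and although `T` may jump, the monotonicity of `T(x)/x` limits its drop as
`1/log(1+x)` falls below `1/log 3` to a factor tending to `1`. -/
theorem le_youngInv_of_lt (hT_div : AntitoneOn (fun x => T x / x) (Ioc 0 1))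
    {Φ : ℝ → ℝ≥0∞} (hΦ : IsYoungFunction Φ)
    {c₁ : ℝ} (hc₁ : 0 < c₁)
    (h : ∀ x : ℝ, 2 < x → c₁ * x * T (1 / Real.log (1 + x)) ≤ youngInv Φ x) {x : ℝ} (hx : 2 ≤ x) :
    c₁ * x * T (1 / Real.log (1 + x)) ≤ youngInv Φ x := by
  rcases hx.lt_or_eq with hx | rfl
  · exact h x hx
  set l := 1 / Real.log (1 + 2) with hl
  obtain ⟨hl0, hl1⟩ := one_div_log_mem (le_refl (2 : ℝ))
  obtain ⟨z₀, hz1, hz2⟩ := ((eventually_ge_atTop (0 : ℝ)).and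
      ((tendsto_order.1 hΦ.tendsto_top).1 _ (ENNReal.ofReal_lt_top (r := 2)))).exists
  refine le_csInf ⟨z₀, hz1, hz2⟩ fun z hz => ?_
  obtain ⟨q, -, hq1, hq2⟩ := ENNReal.lt_iff_exists_real_btwn.mp hz.2
  have hq : 2 < q := (ENNReal.ofReal_lt_ofReal_iff'.mp hq1).1
  have hlim : Tendsto (fun x : ℝ => c₁ * x * (Real.log (1 + 2) / Real.log (1 + x) * T l)) (𝓝[>] 2)
      (𝓝 (c₁ * 2 * (Real.log (1 + 2) / Real.log (1 + 2) * T l))) := by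
    apply tendsto_nhdsWithin_of_tendsto_nhds
    have hc : ContinuousAt (fun x : ℝ => Real.log (1 + x)) 2 :=
      ContinuousAt.log (by fun_prop) (by norm_num)
    have h0 : Real.log (1 + 2) ≠ 0 := by linarith [one_lt_log_one_add (le_refl (2 : ℝ))]
    exact ((continuousAt_const.mul continuousAt_id).mul
      ((continuousAt_const.div hc h0).mul continuousAt_const))
  have h0 : Real.log (1 + 2) ≠ 0 := by linarith [one_lt_log_one_add (le_refl (2 : ℝ))]
  rw [div_self h0, one_mul] at hlim
  refine le_of_tendsto hlim ?_
  filter_upwards [Ioc_mem_nhdsGT hq] with x hx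
  have hLx := one_lt_log_one_add hx.1.le
  have hlog : Real.log (1 + 2) ≤ Real.log (1 + x) :=
    Real.log_le_log (by norm_num) (by linarith [hx.1])
  have hL2 := one_lt_log_one_add (le_refl (2 : ℝ))
  have h1 := rate_mul_le hT_div (one_div_log_mem hx.1.le).1
    (one_div_le_one_div_of_le (by linarith) hlog) hl1.le
  have h2 : Real.log (1 + 2) / Real.log (1 + x) * T l ≤ T (1 / Real.log (1 + x)) := by
    rw [← hl] at h1
    rw [hl, one_div_mul_eq_div, one_div_mul_eq_div, div_le_div_iff₀ (by linarith) (by linarith),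
      ← hl] at h1
    rw [div_mul_eq_mul_div, div_le_iff₀ (by linarith)]
    linarith
  calc c₁ * x * (Real.log (1 + 2) / Real.log (1 + x) * T l)
      ≤ c₁ * x * T (1 / Real.log (1 + x)) := by
        have : 0 < x := by linarith [hx.1]
        gcongr
    _ ≤ youngInv Φ x := h x hx.1
    _ ≤ z := csInf_le ⟨0, fun x hx => hx.1⟩
        ⟨hz.1, (ENNReal.ofReal_le_ofReal hx.2).trans_lt hq2⟩

theorem youngInv_le_of_lt (hT_mono : MonotoneOn T (Icc 0 1))
    {Φ : ℝ → ℝ≥0∞} (hΦ : IsYoungFunction Φ)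
    {c₂ : ℝ} (hc₂ : 0 < c₂)
    (h : ∀ x : ℝ, 2 < x → youngInv Φ x ≤ c₂ * x * T (1 / Real.log (1 + x))) {x : ℝ} (hx : 2 ≤ x) :
    youngInv Φ x ≤ c₂ * x * T (1 / Real.log (1 + x)) := by
  rcases hx.lt_or_eq with hx | rfl
  · exact h x hx
  have hlim : Tendsto (fun x : ℝ => c₂ * x * T (1 / Real.log (1 + 2))) (𝓝[>] 2)
      (𝓝 (c₂ * 2 * T (1 / Real.log (1 + 2)))) := by
    apply tendsto_nhdsWithin_of_tendsto_nhds
    exact Continuous.tendsto (by fun_prop) 2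
  refine ge_of_tendsto hlim ?_
  filter_upwards [self_mem_nhdsWithin] with x hx
  have hx2 : (2 : ℝ) < x := hx
  have hL2 := one_lt_log_one_add (le_refl (2 : ℝ))
  have m1 := one_div_log_mem hx2.le
  have m2 := one_div_log_mem (le_refl (2 : ℝ))
  have hT : T (1 / Real.log (1 + x)) ≤ T (1 / Real.log (1 + 2)) :=
    hT_mono ⟨m1.1.le, m1.2.le⟩ ⟨m2.1.le, m2.2.le⟩
      (one_div_le_one_div_of_le (by linarith) (Real.log_le_log (by norm_num) (by linarith)))
  calc youngInv Φ 2 ≤ youngInv Φ x := youngInv_mono hΦ hx2.le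
    _ ≤ c₂ * x * T (1 / Real.log (1 + x)) := h x hx2
    _ ≤ _ := by gcongr

/-- `T(1/y) ≥ T(1)/y` forces the generalized inverse at `e^y - 1` to grow at least like `(e^y -
1)/y`, hence to be unbounded. A value `Φ z = ∞` would bound it by `|z|`. -/
theorem lt_top_of_le_youngInv (hT_pos : ∀ x ∈ Ioc (0 : ℝ) 1, 0 < T x)
    (hT_div : AntitoneOn (fun x => T x / x) (Ioc 0 1))
    {Φ : ℝ → ℝ≥0∞} (hΦ : IsYoungFunction Φ) {c₁ : ℝ} (hc₁ : 0 < c₁)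
    (h : ∀ x : ℝ, 2 < x → c₁ * x * T (1 / Real.log (1 + x)) ≤ youngInv Φ x) (z : ℝ) :
    Φ z < ⊤ := by
  rw [← hΦ.abs]
  have hT1 : 0 < T 1 := hT_pos 1 ⟨one_pos, le_rfl⟩
  -- With `e^y - 1 ≥ y + y²/2`, the lower bound becomes `c₁ T(1)(1 + y/2)`, and this `y` makes it
  -- exceed `|z|`.
  set y := max 2 (2 * |z| / (c₁ * T 1)) with hy
  have hy2 : 2 ≤ y := le_max_left _ _
  have hyz : 2 * |z| / (c₁ * T 1) ≤ y := le_max_right _ _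
  have hexp := Real.quadratic_le_exp_of_nonneg (by linarith : 0 ≤ y)
  have hx : 2 < Real.exp y - 1 := by nlinarith
  have h1 := h _ hx
  rw [add_sub_cancel, Real.log_exp] at h1
  have h2 := rate_mul_le hT_div (by positivity : 0 < 1 / y) (by
    rw [div_le_one (by linarith)]; linarith) le_rfl
  have h3 : |z| < youngInv Φ (Real.exp y - 1) := by
    refine lt_of_lt_of_le ?_ h1
    rw [div_le_iff₀ (by positivity)] at hyz
    have h4 : c₁ * (y + y ^ 2 / 2) * (1 / y * T 1) ≤ c₁ * (Real.exp y - 1) * T (1 / y) := by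
      gcongr <;> linarith
    have h5 : c₁ * (y + y ^ 2 / 2) * (1 / y * T 1) = c₁ * T 1 + y * (c₁ * T 1) / 2 := by
      field_simp
    have h6 : 0 < c₁ * T 1 := by positivity
    linarith
  exact (le_ofReal_of_lt_youngInv (abs_nonneg z) h3).trans_lt ENNReal.ofReal_lt_top

end Rate

/-! ### Weight of a level set, and a lower bound for the `p`-variance. -/

section Weight

variable {X : Type*} [MeasurableSpace X] {μ : Measure X} [IsProbabilityMeasure μ]

/-- Concavity of the logarithm is the point: bound `log(1+F²/c²)` by the tangent line at `1 + 1/s`.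
Since `∫_A F²/c² ≤ 1` and `(s+1)/(1+1/s) = s`, integrating over `A` gives `s log(1+1/s)` with no
loss. -/
theorem setLIntegral_weight_le {F : X → ℝ} (hFm : Measurable F)
    (hF : Integrable (fun x => F x ^ 2) μ) {c ε : ℝ} (hc : 0 < c)
    (hcsq : c ^ 2 = ∫ x, F x ^ 2 ∂μ) (hε : ε ∈ Ioo (0 : ℝ) 1) {A : Set X}
    (hμA : μ A ≤ 1 / 2) :
    ∫⁻ x in A, ENNReal.ofReal (5 * ε + min 1 (ε * Real.log (1 + F x ^ 2 / c ^ 2))) ∂μ ≤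
      ENNReal.ofReal (6 * (μ.real A * min 1 (ε * Real.log (1 + 1 / μ.real A)))) := by
  set s := μ.real A with hs
  obtain ⟨hε0, hε1⟩ := hε
  rcases eq_or_ne (μ A) 0 with h0 | h0
  · rw [setLIntegral_measure_zero _ _ h0]; exact zero_le
  have hs0 : 0 < s := ENNReal.toReal_pos h0 (measure_ne_top _ _)
  have hs2 : s ≤ 1 / 2 := by
    have := ENNReal.toReal_mono (by simp) hμA
    rw [hs, measureReal_def]
    simpa using this
  have hx2 : 2 ≤ 1 / s := by rw [le_div_iff₀ hs0]; linarith
  have hL := one_lt_log_one_add hx2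
  have hlogF : ∀ x, 0 ≤ Real.log (1 + F x ^ 2 / c ^ 2) := fun x => Real.log_nonneg (by
    have : 0 ≤ F x ^ 2 / c ^ 2 := by positivity
    linarith)
  have hmin0 : ∀ x, 0 ≤ min 1 (ε * Real.log (1 + F x ^ 2 / c ^ 2)) := fun x =>
    le_min zero_le_one (mul_nonneg hε0.le (hlogF x))
  have hmi : Integrable (fun x => min 1 (ε * Real.log (1 + F x ^ 2 / c ^ 2))) (μ.restrict A) :=
    Integrable.of_bound (C := 1) (Measurable.aestronglyMeasurable (by fun_prop))
      (Eventually.of_forall fun x => by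
        rw [Real.norm_of_nonneg (hmin0 x)]; exact min_le_left _ _)
  have hb1 : ∫ x in A, min 1 (ε * Real.log (1 + F x ^ 2 / c ^ 2)) ∂μ ≤ s := by
    calc _ ≤ ∫ x in A, (1 : ℝ) ∂μ := integral_mono hmi (integrable_const _) fun x =>
          min_le_left _ _
      _ = s := by simp [hs]
  have hb2 : ∫ x in A, min 1 (ε * Real.log (1 + F x ^ 2 / c ^ 2)) ∂μ ≤
      s * (ε * Real.log (1 + 1 / s)) := by
    have hx0 : 0 < 1 + 1 / s := by positivity
    have hi : Integrable (fun x => F x ^ 2 / c ^ 2) (μ.restrict A) :=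
      (hF.div_const _).integrableOn
    have hi2 : Integrable (fun x => (1 + F x ^ 2 / c ^ 2) / (1 + 1 / s)) (μ.restrict A) :=
      ((integrable_const _).add hi).div_const _
    have hle1 : ∫ x in A, F x ^ 2 / c ^ 2 ∂μ ≤ 1 := by
      calc _ ≤ ∫ x, F x ^ 2 / c ^ 2 ∂μ :=
            setIntegral_le_integral (hF.div_const _) (Eventually.of_forall fun x => by positivity)
        _ = 1 := by rw [integral_div, ← hcsq, div_self (by positivity)]
    calc _ ≤ ∫ x in A, ε * (Real.log (1 + 1 / s) - 1 + (1 + F x ^ 2 / c ^ 2) / (1 + 1 / s)) ∂μ := by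
          refine integral_mono hmi (((integrable_const _).add hi2).const_mul _) fun x => ?_
          refine (min_le_right _ _).trans ?_
          have h1 : 0 < 1 + F x ^ 2 / c ^ 2 := by positivity
          have h2 := Real.log_le_sub_one_of_pos (div_pos h1 hx0)
          rw [Real.log_div h1.ne' hx0.ne'] at h2
          apply mul_le_mul_of_nonneg_left _ hε0.le
          linarith
      _ = ε * (s * (Real.log (1 + 1 / s) - 1) + (s + ∫ x in A, F x ^ 2 / c ^ 2 ∂μ) / (1 + 1 / s)) := by
          rw [integral_const_mul, integral_add (integrable_const _) hi2, integral_div,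
            integral_add (integrable_const _) hi]
          simp [hs]
      _ ≤ ε * (s * (Real.log (1 + 1 / s) - 1) + (s + 1) / (1 + 1 / s)) := by gcongr
      _ = s * (ε * Real.log (1 + 1 / s)) := by field_simp; ring
  -- Here `s ≤ 1/2` enters through `log(1+1/s) > 1`. The term `5ε` is absorbed into five more copies
  -- of the minimum, whence the factor `6`.
  have hψ : ε ≤ min 1 (ε * Real.log (1 + 1 / s)) := le_min hε1.le (by nlinarith)
  have hWi : Integrable (fun x => 5 * ε + min 1 (ε * Real.log (1 + F x ^ 2 / c ^ 2)))
      (μ.restrict A) := (integrable_const _).add hmi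
  rw [← ofReal_integral_eq_lintegral_ofReal hWi
    (Eventually.of_forall fun x => by have := hmin0 x; positivity)]
  apply ENNReal.ofReal_le_ofReal
  rw [integral_add (integrable_const _) hmi]
  have h5 : ∫ x in A, 5 * ε ∂μ = s * (5 * ε) := by simp [hs]
  rw [h5]
  have h6 : ∫ x in A, min 1 (ε * Real.log (1 + F x ^ 2 / c ^ 2)) ∂μ ≤
      s * min 1 (ε * Real.log (1 + 1 / s)) := by
    rcases min_choice 1 (ε * Real.log (1 + 1 / s)) with h | h <;> rw [h]
    · rw [mul_one]; exact hb1
    · exact hb2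
  nlinarith [mul_le_mul_of_nonneg_left hψ hs0.le]

/-- Reverse Hölder lower bound for the `p`-variance of a function supported on at most half of
the space. -/
theorem le_integral_sq_sub_rpow {u : X → ℝ} (hum : Measurable u) (hu : MemLp u 2 μ)
    (hu0 : ∀ x, 0 ≤ u x) (hsupp : μ {x | u x ≠ 0} ≤ 1 / 2) {A : Set X} (hA : MeasurableSet A)
    (hs0 : 0 < μ.real A) {a : ℝ} (ha : 0 < a) (hau : ∀ x ∈ A, a ≤ u x) {p : ℝ} (hp1 : 1 < p)
    (hp2 : p < 2) :
    a ^ 2 * (μ.real A * (1 - (1 + 1 / (2 * μ.real A)) ^ (-((2 - p) / p)))) ≤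
      ∫ x, u x ^ 2 ∂μ - (∫ x, |u x| ^ p ∂μ) ^ (2 / p) := by
  set s := μ.real A with hs
  -- Hölder is applied with weight `b` on `A` and `1` on the rest of the support. This `b` uses up
  -- the free half of the space: the weight has total mass at most `1/2 + (b-1)s = 1`.
  set b := 1 + 1 / (2 * s) with hb
  set h := b ^ (-((2 - p) / p)) with hh
  have hp0 : 0 < p := by linarith
  have hb1 : 1 ≤ b := by
    have : 0 ≤ 1 / (2 * s) := by positivity
    linarith
  have hb0 : 0 < b := by linarith
  have hh0 : 0 < h := Real.rpow_pos_of_pos hb0 _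
  have hh1 : h ≤ 1 := Real.rpow_le_one_of_one_le_of_nonpos hb1 (by
    have : 0 ≤ (2 - p) / p := div_nonneg (by linarith) hp0.le
    linarith)
  have hi2 : Integrable (fun x => u x ^ 2) μ := hu.integrable_sq
  have hip : Integrable (fun x => |u x| ^ p) μ := by
    have h1 : MemLp u (ENNReal.ofReal p) μ := hu.mono_exponent (by
      rw [← ENNReal.ofReal_ofNat]; exact ENNReal.ofReal_le_ofReal hp2.le)
    have h2 := h1.integrable_norm_rpow (by simpa using by linarith) ENNReal.ofReal_ne_top
    rwa [ENNReal.toReal_ofReal (by linarith)] at h2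
  have hSm : MeasurableSet {x | u x ≠ 0} := (measurableSet_eq_fun hum measurable_const).compl
  have hAS : A ⊆ {x | u x ≠ 0} := fun x hx => (ha.trans_le (hau x hx)).ne'
  have hiA : Integrable (A.indicator fun x => u x ^ 2) μ := hi2.indicator hA
  set Q := ∫ x, (u x ^ 2 - (1 - h) * A.indicator (fun x => u x ^ 2) x) ∂μ with hQ
  have hQeq : Q = ∫ x, u x ^ 2 ∂μ - (1 - h) * ∫ x in A, u x ^ 2 ∂μ := by
    rw [hQ, integral_sub hi2 (hiA.const_mul _), integral_const_mul, integral_indicator hA]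
  have hAle : a ^ 2 * s ≤ ∫ x in A, u x ^ 2 ∂μ := by
    calc a ^ 2 * s = ∫ x in A, a ^ 2 ∂μ := by simp [hs, mul_comm]
      _ ≤ _ := setIntegral_mono_on (integrable_const _) hi2.integrableOn hA fun x hx =>
        pow_le_pow_left₀ ha.le (hau x hx) 2
  have hAle2 : ∫ x in A, u x ^ 2 ∂μ ≤ ∫ x, u x ^ 2 ∂μ :=
    setIntegral_le_integral hi2 (Eventually.of_forall fun x => sq_nonneg _)
  have hQ0 : 0 < Q := by
    rw [hQeq]
    have : 0 < a ^ 2 * s := by positivity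
    nlinarith
  set Λ := √Q with hΛ
  have hΛ0 : 0 < Λ := Real.sqrt_pos.mpr hQ0
  have hΛ2 : Λ ^ 2 = Q := Real.sq_sqrt hQ0.le
  -- This is the pointwise form of Hölder with exponents `2/p` and `2/(2-p)`, normalised by `Λ² =
  -- Q`. The power of `β` is the one that cancels in the geometric mean, so weight `b` multiplies
  -- `u²` by `h` on `A`.
  have young : ∀ β y : ℝ, 0 < β → 0 ≤ y →
      y ^ p ≤ Λ ^ p * (p / 2 * (y ^ 2 * β ^ (-((2 - p) / p)) / Λ ^ 2) + (2 - p) / 2 * β) := by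
    intro β y hβ hy
    have hβ' : 0 < β ^ (-((2 - p) / p)) := Real.rpow_pos_of_pos hβ _
    have h1 := Real.geom_mean_le_arith_mean2_weighted (w₁ := p / 2) (w₂ := (2 - p) / 2)
      (p₁ := y ^ 2 * β ^ (-((2 - p) / p)) / Λ ^ 2) (p₂ := β) (by linarith) (by linarith)
      (by positivity) hβ.le (by ring)
    have h2 : (y ^ 2 * β ^ (-((2 - p) / p)) / Λ ^ 2) ^ (p / 2) * β ^ ((2 - p) / 2) =
        y ^ p / Λ ^ p := by
      have e1 : (y ^ 2) ^ (p / 2) = y ^ p := by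
        rw [← Real.rpow_two, ← Real.rpow_mul hy, mul_div_cancel₀ p two_ne_zero]
      have e2 : (Λ ^ 2) ^ (p / 2) = Λ ^ p := by
        rw [← Real.rpow_two, ← Real.rpow_mul hΛ0.le, mul_div_cancel₀ p two_ne_zero]
      have e3 : (β ^ (-((2 - p) / p))) ^ (p / 2) * β ^ ((2 - p) / 2) = 1 := by
        rw [← Real.rpow_mul hβ.le, ← Real.rpow_add hβ]
        have : -((2 - p) / p) * (p / 2) + (2 - p) / 2 = 0 := by field_simp; ring
        rw [this, Real.rpow_zero]
      rw [Real.div_rpow (by positivity) (by positivity), Real.mul_rpow (by positivity) hβ'.le,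
        e1, e2, div_mul_eq_mul_div, mul_assoc, e3, mul_one]
    rw [h2, div_le_iff₀ (by positivity)] at h1
    linarith
  set G : X → ℝ := fun x => {x | u x ≠ 0}.indicator (fun _ => (1 : ℝ)) x +
    (b - 1) * A.indicator (fun _ => (1 : ℝ)) x with hG
  have hiS : Integrable ({x | u x ≠ 0}.indicator (fun _ => (1 : ℝ))) μ :=
    (integrable_const _).indicator hSm
  have hiA1 : Integrable (A.indicator (fun _ => (1 : ℝ))) μ := (integrable_const _).indicator hA
  have hiG : Integrable G μ := hiS.add (hiA1.const_mul _)
  have hGle : ∫ x, G x ∂μ ≤ 1 := by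
    have h1 : μ.real {x | u x ≠ 0} ≤ 1 / 2 := by
      have := ENNReal.toReal_mono (by simp) hsupp
      rw [measureReal_def]
      simpa using this
    have h2 : (b - 1) * s = 1 / 2 := by rw [hb]; field_simp; ring
    rw [hG, integral_add hiS (hiA1.const_mul _), integral_const_mul, integral_indicator hSm,
      integral_indicator hA]
    simp only [integral_const, MeasurableSet.univ, measureReal_restrict_apply, univ_inter,
      smul_eq_mul, mul_one]
    rw [← hs, h2]
    linarith
  have hiQ : Integrable (fun x => u x ^ 2 - (1 - h) * A.indicator (fun x => u x ^ 2) x) μ :=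
    hi2.sub (hiA.const_mul _)
  have hpt : ∀ x, |u x| ^ p ≤ Λ ^ p * (p / 2 *
      ((u x ^ 2 - (1 - h) * A.indicator (fun x => u x ^ 2) x) / Λ ^ 2) + (2 - p) / 2 * G x) := by
    intro x
    rw [abs_of_nonneg (hu0 x)]
    simp only [hG]
    by_cases hxA : x ∈ A
    · rw [indicator_of_mem hxA, indicator_of_mem hxA, indicator_of_mem (hAS hxA)]
      have := young b (u x) hb0 (hu0 x)
      rw [← hh] at this
      refine this.trans (le_of_eq ?_)
      ring
    · rw [indicator_of_notMem hxA, indicator_of_notMem hxA]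
      by_cases hxS : u x = 0
      · rw [indicator_of_notMem (by simpa using hxS), hxS, Real.zero_rpow hp0.ne']
        simp
      · rw [indicator_of_mem (show x ∈ {x | u x ≠ 0} from hxS)]
        have := young 1 (u x) one_pos (hu0 x)
        rw [Real.one_rpow] at this
        refine this.trans (le_of_eq ?_)
        ring
  have hΛp : 0 < Λ ^ p := Real.rpow_pos_of_pos hΛ0 p
  have hle : ∫ x, |u x| ^ p ∂μ ≤ Λ ^ p := by
    calc _ ≤ ∫ x, Λ ^ p * (p / 2 * ((u x ^ 2 - (1 - h) * A.indicator (fun x => u x ^ 2) x) /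
          Λ ^ 2) + (2 - p) / 2 * G x) ∂μ :=
          integral_mono hip ((((hiQ.div_const _).const_mul _).add (hiG.const_mul _)).const_mul _)
            hpt
      _ = Λ ^ p * (p / 2 * (Q / Λ ^ 2) + (2 - p) / 2 * ∫ x, G x ∂μ) := by
          rw [integral_const_mul, integral_add ((hiQ.div_const _).const_mul _)
            (hiG.const_mul _), integral_const_mul, integral_const_mul, integral_div]
      _ ≤ Λ ^ p * (p / 2 * (Q / Λ ^ 2) + (2 - p) / 2 * 1) := by
          gcongr
      _ = Λ ^ p := by
          rw [hΛ2, div_self hQ0.ne']; ring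
  have hfin : (∫ x, |u x| ^ p ∂μ) ^ (2 / p) ≤ Q := by
    calc _ ≤ (Λ ^ p) ^ (2 / p) :=
          Real.rpow_le_rpow (integral_nonneg fun x => by positivity) hle (by positivity)
      _ = Q := by
          rw [← Real.rpow_mul hΛ0.le, mul_div_cancel₀ _ hp0.ne', Real.rpow_two, hΛ2]
  calc a ^ 2 * (s * (1 - h)) = (1 - h) * (a ^ 2 * s) := by ring
    _ ≤ (1 - h) * ∫ x in A, u x ^ 2 ∂μ := by gcongr
    _ = ∫ x, u x ^ 2 ∂μ - Q := by rw [hQeq]; ring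
    _ ≤ _ := by linarith

/-- Since `(1+1/(2s))² ≥ 1+1/s`, the chosen `p` makes `(2-p) log(1+1/(2s))` at least `1/2`, and
dividing by `p < 2` leaves at least `1/4`. Finally `e^(1/4) ≥ 41/32 ≥ 32/25` gives `1 - e^(-1/4) ≥
7/32`. -/
theorem one_sub_rpow_log_ge {s : ℝ} (hs0 : 0 < s) {p : ℝ} (hp1 : 1 < p) (hp2 : p < 2)
    (hp : 2 - p = 1 / Real.log (1 + 1 / s)) :
    7 / 32 ≤ 1 - (1 + 1 / (2 * s)) ^ (-((2 - p) / p)) := by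
  have hL : 0 < Real.log (1 + 1 / s) := Real.log_pos (by
    have : 0 < 1 / s := by positivity
    linarith)
  have hb0 : 0 < 1 + 1 / (2 * s) := by positivity
  have h1 : 1 / 2 * Real.log (1 + 1 / s) ≤ Real.log (1 + 1 / (2 * s)) := by
    have h2 : Real.log (1 + 1 / s) ≤ Real.log ((1 + 1 / (2 * s)) ^ 2) := by
      apply Real.log_le_log (by positivity)
      have : (1 + 1 / (2 * s)) ^ 2 = 1 + 1 / s + (1 / (2 * s)) ^ 2 := by field_simp; ring
      rw [this]
      linarith [sq_nonneg (1 / (2 * s))]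
    rw [Real.log_pow] at h2
    push_cast at h2
    linarith
  have h3 : 1 / 4 ≤ Real.log (1 + 1 / (2 * s)) * ((2 - p) / p) := by
    have h4 : 1 / 2 ≤ Real.log (1 + 1 / (2 * s)) * (2 - p) := by
      calc 1 / 2 = 1 / 2 * Real.log (1 + 1 / s) * (2 - p) := by
            rw [hp, mul_assoc, mul_one_div_cancel hL.ne', mul_one]
        _ ≤ _ := by gcongr
    rw [← mul_div_assoc, le_div_iff₀ (by linarith)]
    linarith
  have h5 : (1 + 1 / (2 * s)) ^ (-((2 - p) / p)) ≤ Real.exp (-(1 / 4)) := by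
    rw [Real.rpow_def_of_pos hb0]
    apply Real.exp_le_exp.mpr
    linarith
  have h6 : Real.exp (-(1 / 4)) ≤ 25 / 32 := by
    rw [Real.exp_neg, inv_le_comm₀ (Real.exp_pos _) (by norm_num)]
    have := Real.quadratic_le_exp_of_nonneg (x := 1 / 4) (by norm_num)
    norm_num at this ⊢
    linarith
  linarith

end Weight
-- Capacity estimates drawn from each inequality.
variable {n : ℕ} {μ ν : Measure (EuclideanSpace ℝ (Fin n))}
  {T : ℝ → ℝ} {Φ : ℝ → ℝ≥0∞} {C : ℝ≥0∞}

theorem OrliczSobolevIneq.mono {C' : ℝ≥0∞} (h : OrliczSobolevIneq Φ μ ν C) (hC : C ≤ C') :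
    OrliczSobolevIneq Φ μ ν C' := fun f hf hfi => (h f hf hfi).trans (by gcongr)

theorem BecknerIneq.mono {C' : ℝ≥0∞} (h : BecknerIneq T μ ν C) (hC : C ≤ C') :
    BecknerIneq T μ ν C' := fun f hf hfi => (h f hf hfi).trans (by gcongr)

variable [IsProbabilityMeasure μ]

/-- The capacity estimate contained in the Orlicz–Sobolev inequality. -/
theorem OrliczSobolevIneq.level_le (hOS : OrliczSobolevIneq Φ μ ν C)
    (hΦ : IsYoungFunction Φ) (hT_pos : ∀ x ∈ Ioc (0 : ℝ) 1, 0 < T x) {c₂ : ℝ} (hc₂ : 0 < c₂)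
    (hup : ∀ x : ℝ, 2 ≤ x → youngInv Φ x ≤ c₂ * x * T (1 / Real.log (1 + x)))
    {u : EuclideanSpace ℝ (Fin n) → ℝ} (hu : ContDiff ℝ ∞ u) (hui : Integrable u μ)
    {A : Set (EuclideanSpace ℝ (Fin n))} (hA : MeasurableSet A) (hA0 : 0 < μ.real A)
    (hA2 : μ A ≤ 1 / 2) (hsupp : 1 / 2 ≤ μ {x | u x ≤ 0}) {a : ℝ} (ha : 0 < a)
    (hau : ∀ x ∈ A, a ≤ u x) :
    ENNReal.ofReal (a ^ 2 * μ.real A) ≤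
      ENNReal.ofReal (4 * c₂ * T (1 / Real.log (1 + 1 / μ.real A))) * (C * energy ν u) := by
  set s := μ.real A with hs
  have hs2 : s ≤ 1 / 2 := by
    have := ENNReal.toReal_mono (by simp) hA2
    rw [hs, measureReal_def]
    simpa using this
  have hx2 : 2 ≤ 1 / s := by rw [le_div_iff₀ hA0]; linarith
  have hl := one_div_log_mem hx2
  have hT := hT_pos _ ⟨hl.1, hl.2.le⟩
  have hum : Measurable u := hu.continuous.measurable
  set q := ∫ x, u x ∂μ with hq
  -- Either the mean is at most `a/2` and `u` is far from it on `A`, or it is larger and `u` is far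
  -- from it on `{u ≤ 0}`, whose measure is no smaller than that of `A`. The loss `(a/2)²` is the
  -- source of the factor `4`.
  obtain ⟨B, hBm, hB, hBu⟩ : ∃ B, MeasurableSet B ∧ μ A ≤ μ B ∧ ∀ x ∈ B, a ^ 2 / 4 ≤ (u x - q) ^ 2 := by
    rcases le_total q (a / 2) with h | h
    · refine ⟨A, hA, le_rfl, fun x hx => ?_⟩
      nlinarith [hau x hx]
    · refine ⟨{x | u x ≤ 0}, measurableSet_le hum measurable_const, hA2.trans hsupp,
        fun x hx => ?_⟩
      have hx0 : u x ≤ 0 := hx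
      nlinarith
  have key : ∀ r : ℝ, C * energy ν u < ENNReal.ofReal r →
      a ^ 2 * s ≤ 4 * c₂ * T (1 / Real.log (1 + 1 / s)) * r := by
    intro r hr
    have hr0 : 0 < r := ENNReal.ofReal_pos.mp (pos_of_gt hr)
    have h1 := lintegral_le_one_of_luxemburgNorm_lt hΦ ((hOS u hu hui).trans_lt hr)
    have h2 : Φ (a ^ 2 / 4 / r) * μ A ≤ 1 := by
      calc Φ (a ^ 2 / 4 / r) * μ A ≤ Φ (a ^ 2 / 4 / r) * μ B := by gcongr
        _ = ∫⁻ _ in B, Φ (a ^ 2 / 4 / r) ∂μ := by rw [setLIntegral_const]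
        _ ≤ ∫⁻ x in B, Φ ((u x - q) ^ 2 / r) ∂μ :=
          setLIntegral_mono' hBm fun x hx => hΦ.mono (by positivity) (by
            have := hBu x hx
            gcongr)
        _ ≤ _ := setLIntegral_le_lintegral _ _
        _ ≤ 1 := h1
    have h3 : Φ (a ^ 2 / 4 / r) ≤ ENNReal.ofReal (1 / s) := by
      have hμA : μ A = ENNReal.ofReal s := by rw [hs, ofReal_measureReal]
      rw [hμA] at h2
      rw [one_div, ENNReal.ofReal_inv_of_pos hA0]
      exact ENNReal.le_inv_iff_mul_le.mpr h2
    have h4 := (hΦ.le_youngInv h3).trans (hup _ hx2)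
    rw [div_le_iff₀ hr0] at h4
    have h5 : c₂ * (1 / s) * T (1 / Real.log (1 + 1 / s)) * r * s =
        c₂ * T (1 / Real.log (1 + 1 / s)) * r := by field_simp
    have h6 := mul_le_mul_of_nonneg_right h4 hA0.le
    rw [h5] at h6
    linarith
  have hK : 0 < 4 * c₂ * T (1 / Real.log (1 + 1 / s)) := by positivity
  rcases eq_or_ne (C * energy ν u) ⊤ with htop | htop
  · rw [htop, ENNReal.mul_top (by simpa using hK)]; exact le_top
  have h7 : a ^ 2 * s / (4 * c₂ * T (1 / Real.log (1 + 1 / s))) ≤ (C * energy ν u).toReal := by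
    refine le_of_forall_gt_imp_ge_of_dense fun r hr => ?_
    rw [div_le_iff₀' hK]
    exact key r ((ENNReal.lt_ofReal_iff_toReal_lt htop).mpr hr)
  rw [← ENNReal.ofReal_toReal htop, ← ENNReal.ofReal_mul hK.le]
  apply ENNReal.ofReal_le_ofReal
  rwa [div_le_iff₀' hK] at h7

/-- The capacity estimate contained in the Beckner-type inequality. -/
theorem BecknerIneq.level_le (hB : BecknerIneq T μ ν C)
    (hT_pos : ∀ x ∈ Ioc (0 : ℝ) 1, 0 < T x)
    {u : EuclideanSpace ℝ (Fin n) → ℝ} (hu : ContDiff ℝ ∞ u) (hui : MemLp u 2 μ)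
    (hu0 : ∀ x, 0 ≤ u x) (hsupp : μ {x | u x ≠ 0} ≤ 1 / 2)
    {A : Set (EuclideanSpace ℝ (Fin n))} (hA : MeasurableSet A) (hA0 : 0 < μ.real A)
    (hA2 : μ A ≤ 1 / 2) {a : ℝ} (ha : 0 < a) (hau : ∀ x ∈ A, a ≤ u x) :
    ENNReal.ofReal (7 / 32 * (a ^ 2 * μ.real A)) ≤
      ENNReal.ofReal (T (1 / Real.log (1 + 1 / μ.real A))) * (C * energy ν u) := by
  set s := μ.real A with hs
  have hs2 : s ≤ 1 / 2 := by
    have := ENNReal.toReal_mono (by simp) hA2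
    rw [hs, measureReal_def]
    simpa using this
  have hx2 : 2 ≤ 1 / s := by rw [le_div_iff₀ hA0]; linarith
  obtain ⟨hl0, hl1⟩ := one_div_log_mem hx2
  -- The exponent `p = 2 - l` matches the size of `A`: it makes the gain a fixed fraction of `a² s`
  -- while the denominator in (B) is exactly `T l`.
  set l := 1 / Real.log (1 + 1 / s) with hl
  have hT := hT_pos _ ⟨hl0, hl1.le⟩
  have hp1 : 1 < 2 - l := by linarith
  have hp2 : 2 - l < 2 := by linarith
  have h1 := le_integral_sq_sub_rpow hu.continuous.measurable hui hu0 hsupp hA hA0 ha hau hp1 hp2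
  have h2 := one_sub_rpow_log_ge hA0 hp1 hp2 (sub_sub_cancel 2 l)
  have h3 := (le_iSup₂ (f := fun p (_ : p ∈ Ioo (1 : ℝ) 2) => ENNReal.ofReal
    ((∫ x, u x ^ 2 ∂μ - (∫ x, |u x| ^ p ∂μ) ^ (2 / p)) / T (2 - p))) (2 - l)
    ⟨hp1, hp2⟩).trans (hB u hu hui)
  rw [sub_sub_cancel] at h3
  rw [← hs] at h1
  calc ENNReal.ofReal (7 / 32 * (a ^ 2 * s)) = ENNReal.ofReal (T l) *
        ENNReal.ofReal (7 / 32 * (a ^ 2 * s) / T l) := by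
        rw [← ENNReal.ofReal_mul hT.le, mul_div_cancel₀ _ hT.ne']
    _ ≤ ENNReal.ofReal (T l) * (C * energy ν u) := by
        gcongr
        refine le_trans (ENNReal.ofReal_le_ofReal ?_) h3
        gcongr
        refine le_trans ?_ h1
        calc 7 / 32 * (a ^ 2 * s) = a ^ 2 * (s * (7 / 32)) := by ring
          _ ≤ _ := by gcongr

/-! ### Summing the level estimates in both directions. -/

theorem IsCutoff.memLp {η : ℝ → ℝ} (hη : IsCutoff η) {F : EuclideanSpace ℝ (Fin n) → ℝ}
    (hF : Measurable F) (t : ℝ) (p : ℝ≥0∞) : MemLp (fun x => η (F x / t)) p μ :=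
  MemLp.of_bound (hη.contDiff.continuous.measurable.comp (hF.div_const t)).aestronglyMeasurable
    (η 1) (Eventually.of_forall fun x => by
      rw [Real.norm_of_nonneg (hη.nonneg _)]; exact hη.le _)

theorem IsCutoff.contDiff_comp {η : ℝ → ℝ} (hη : IsCutoff η) {F : EuclideanSpace ℝ (Fin n) → ℝ}
    (hF : ContDiff ℝ ∞ F) (t : ℝ) : ContDiff ℝ ∞ fun x => η (F x / t) :=
  hη.contDiff.comp (hF.div_const t)

theorem IsCutoff.le_of_lt {η : ℝ → ℝ} (hη : IsCutoff η) {y t : ℝ} (ht : 0 < t) (hy : t < y) :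
    9 / 10 ≤ η (y / t) := by
  rw [hη.eq_one _ (by rw [le_div_iff₀ ht]; linarith)]
  exact hη.le_one

/-- The left side is the weight bound of one level set; the capacity estimate with `a = 9/10`
replaces `s` by an energy and `rate_mul_min_le` removes `s` from the rate. The constant is `6 ·
(100/81) · 4 = 2400/81`, rounded up to `40`. -/
theorem OrliczSobolevIneq.layer_le (hOS : OrliczSobolevIneq Φ μ ν C)
    (hΦ : IsYoungFunction Φ) (hT_pos : ∀ x ∈ Ioc (0 : ℝ) 1, 0 < T x)
    (hT_mono : MonotoneOn T (Icc 0 1)) (hT_div : AntitoneOn (fun x => T x / x) (Ioc 0 1))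
    {c₂ : ℝ} (hc₂ : 0 < c₂)
    (hup : ∀ x : ℝ, 2 ≤ x → youngInv Φ x ≤ c₂ * x * T (1 / Real.log (1 + x)))
    {η : ℝ → ℝ} (hη : IsCutoff η) {F : EuclideanSpace ℝ (Fin n) → ℝ} (hF : ContDiff ℝ ∞ F)
    (hmed : μ {x | 0 < F x} ≤ 1 / 2) {ε : ℝ} (hε : ε ∈ Ioo (0 : ℝ) 1) {t : ℝ} (ht : 0 < t) :
    ENNReal.ofReal (6 * (μ.real {x | t < F x} *
        min 1 (ε * Real.log (1 + 1 / μ.real {x | t < F x})))) ≤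
      ENNReal.ofReal (40 * c₂ * T ε) * C * energy ν (fun x => η (F x / t)) := by
  have hFm : Measurable F := hF.continuous.measurable
  set A := {x | t < F x} with hA
  have hAm : MeasurableSet A := measurableSet_lt measurable_const hFm
  have hAle : μ A ≤ 1 / 2 := (measure_mono fun x (hx : t < F x) => ht.trans hx).trans hmed
  rcases (measureReal_nonneg (μ := μ) (s := A)).eq_or_lt with h0 | h0
  · rw [← h0]; simp
  have hs2 : μ.real A ≤ 1 / 2 := by
    have := ENNReal.toReal_mono (by simp) hAle
    rw [measureReal_def]
    simpa using this
  have hx2 : 2 ≤ 1 / μ.real A := by rw [le_div_iff₀ h0]; linarith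
  have hsupp : 1 / 2 ≤ μ {x | η (F x / t) ≤ 0} := by
    have h1 : {x | 0 < F x}ᶜ ⊆ {x | η (F x / t) ≤ 0} := fun x hx => by
      have hx' : F x ≤ 0 := not_lt.mp hx
      exact (hη.eq_zero _ (div_nonpos_of_nonpos_of_nonneg hx' ht.le)).le
    refine le_trans ?_ (measure_mono h1)
    rw [prob_compl_eq_one_sub (measurableSet_lt measurable_const hFm)]
    calc (1 / 2 : ℝ≥0∞) = 1 - 1 / 2 := by rw [one_div, ENNReal.one_sub_inv_two]
      _ ≤ _ := tsub_le_tsub_left hmed _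
  have hcap := hOS.level_le hΦ hT_pos hc₂ hup (hη.contDiff_comp hF t)
    ((hη.memLp hFm t 1).integrable le_rfl) hAm h0 hAle hsupp (by norm_num : (0 : ℝ) < 9 / 10)
    (fun x hx => hη.le_of_lt ht hx)
  set s := μ.real A with hs
  set w := min 1 (ε * Real.log (1 + 1 / s)) with hw
  have hL := one_lt_log_one_add hx2
  have hw0 : 0 ≤ w := le_min zero_le_one (mul_nonneg hε.1.le (by linarith))
  have hrate := rate_mul_min_le hT_pos hT_mono hT_div hx2 hε
  have hTε := hT_pos ε ⟨hε.1, hε.2.le⟩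
  calc ENNReal.ofReal (6 * (s * w))
      = ENNReal.ofReal (600 / 81 * w) * ENNReal.ofReal ((9 / 10) ^ 2 * s) := by
        rw [← ENNReal.ofReal_mul (by positivity)]
        congr 1; ring
    _ ≤ ENNReal.ofReal (600 / 81 * w) * (ENNReal.ofReal (4 * c₂ * T (1 / Real.log (1 + 1 / s))) *
          (C * energy ν fun x => η (F x / t))) := by gcongr
    _ = ENNReal.ofReal (600 / 81 * w * (4 * c₂ * T (1 / Real.log (1 + 1 / s)))) * C *
          energy ν (fun x => η (F x / t)) := by
        rw [ENNReal.ofReal_mul (p := 600 / 81 * w) (by positivity)]; ring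
    _ ≤ ENNReal.ofReal (40 * c₂ * T ε) * C * energy ν (fun x => η (F x / t)) := by
        gcongr ENNReal.ofReal ?_ * C * _
        have h1 : 600 / 81 * w * (4 * c₂ * T (1 / Real.log (1 + 1 / s))) =
          2400 / 81 * c₂ * (T (1 / Real.log (1 + 1 / s)) * w) := by ring
        rw [h1]
        calc _ ≤ 2400 / 81 * c₂ * T ε := by gcongr
          _ ≤ 40 * c₂ * T ε := by gcongr; norm_num

theorem OrliczSobolevIneq.becknerIneq (hOS : OrliczSobolevIneq Φ μ ν C) (hC : C ≠ 0)
    (hΦ : IsYoungFunction Φ) (hT_pos : ∀ x ∈ Ioc (0 : ℝ) 1, 0 < T x)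
    (hT_mono : MonotoneOn T (Icc 0 1)) (hT_div : AntitoneOn (fun x => T x / x) (Ioc 0 1))
    {c₂ : ℝ} (hc₂ : 0 < c₂)
    (hup : ∀ x : ℝ, 2 ≤ x → youngInv Φ x ≤ c₂ * x * T (1 / Real.log (1 + x))) :
    BecknerIneq T μ ν (ENNReal.ofReal (160 * c₂) * C) := by
  intro f hf hf2
  rcases eq_or_ne (energy ν f) ⊤ with hE | hE
  · rw [hE, ENNReal.mul_top (mul_ne_zero (by simpa using hc₂) hC)]; exact le_top
  refine iSup₂_le fun p hp => ?_
  have hp0 : 0 < p := by linarith [hp.1]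
  have hε : 2 - p ∈ Ioo (0 : ℝ) 1 := ⟨by linarith [hp.2], by linarith [hp.1]⟩
  have hTε := hT_pos _ ⟨hε.1, hε.2.le⟩
  have hfm : Measurable f := hf.continuous.measurable
  obtain ⟨m, hm1, hm2⟩ := exists_median (μ := μ) hfm
  set F : EuclideanSpace ℝ (Fin n) → ℝ := fun x => f x - m with hFdef
  have hF : ContDiff ℝ ∞ F := hf.sub contDiff_const
  have hFm : Measurable F := hF.continuous.measurable
  have hFL : MemLp F 2 μ := hf2.sub (memLp_const m)
  have hFi : Integrable (fun x => F x ^ 2) μ := hFL.integrable_sq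
  have hEF : energy ν F = energy ν f := energy_sub_const f m
  have hpos : μ {x | 0 < F x} ≤ 1 / 2 := by simpa [F] using hm1
  have hneg : μ {x | 0 < -F x} ≤ 1 / 2 := by simpa [F] using hm2
  -- If `f` is almost everywhere its median, the scale `c` would vanish, but the numerator in (B) is
  -- then zero.
  rcases (integral_nonneg fun x => sq_nonneg (F x) : 0 ≤ ∫ x, F x ^ 2 ∂μ).eq_or_lt with h0 | h0
  · have hae : ∀ᵐ x ∂μ, f x = m := by
      have := (integral_eq_zero_iff_of_nonneg (fun x => sq_nonneg (F x)) hFi).mp h0.symm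
      filter_upwards [this] with x hx
      have : F x = 0 := by simpa using hx
      simp only [F] at this
      linarith
    have h1 : ∫ x, f x ^ 2 ∂μ = m ^ 2 := by
      rw [integral_congr_ae (g := fun _ => m ^ 2) (hae.mono fun x hx => by simp [hx])]; simp
    have h2 : ∫ x, |f x| ^ p ∂μ = |m| ^ p := by
      rw [integral_congr_ae (g := fun _ => |m| ^ p) (hae.mono fun x hx => by simp [hx])]; simp
    rw [h1, h2, ← Real.rpow_mul (abs_nonneg m), mul_div_cancel₀ _ hp0.ne', Real.rpow_two, sq_abs,
      sub_self, zero_div, ENNReal.ofReal_zero]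
    exact zero_le
  set c := √(∫ x, F x ^ 2 ∂μ) with hc
  have hc0 : 0 < c := Real.sqrt_pos.mpr h0
  have hcsq : c ^ 2 = ∫ x, F x ^ 2 ∂μ := Real.sq_sqrt h0.le
  have hmain := integral_sq_sub_rpow_le hfm hf2 hp.1 hp.2 m hc0 hcsq
  set W : EuclideanSpace ℝ (Fin n) → ℝ := fun x =>
    5 * (2 - p) + min 1 ((2 - p) * Real.log (1 + F x ^ 2 / c ^ 2)) with hW
  have hW0 : ∀ x, 0 ≤ W x := fun x => by
    have h1 : 0 ≤ F x ^ 2 / c ^ 2 := by positivity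
    have h2 : 0 ≤ min 1 ((2 - p) * Real.log (1 + F x ^ 2 / c ^ 2)) :=
      le_min zero_le_one (mul_nonneg hε.1.le (Real.log_nonneg (by linarith)))
    have := hε.1
    simp only [hW]
    linarith
  have hWm : Measurable W := by fun_prop
  obtain ⟨η, hη⟩ := exists_isCutoff
  -- The layer cake formula for `F²` is taken with respect to the weighted measure, so only the
  -- weights of level sets are needed. Maz'ya's factor `4` times `40` gives `160`.
  set ρ := μ.withDensity fun x => ENNReal.ofReal (W x) with hρ
  have hlev : ∀ t > 0, ρ {x | t < |F x|} ≤ ENNReal.ofReal (40 * c₂ * T (2 - p)) * C *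
      (energy ν (fun x => η (F x / t)) + energy ν (fun x => η (-F x / t))) := by
    intro t ht
    have hsub : {x | t < |F x|} ⊆ {x | t < F x} ∪ {x | t < -F x} := fun x hx => by
      have hx' : t < |F x| := hx
      exact lt_abs.mp hx'
    have hm1 : MeasurableSet {x | t < F x} := measurableSet_lt measurable_const hFm
    have hm2 : MeasurableSet {x | t < -F x} := measurableSet_lt measurable_const hFm.neg
    rw [mul_add]
    refine (measure_mono hsub).trans ((measure_union_le _ _).trans (add_le_add ?_ ?_))
    · rw [hρ, withDensity_apply _ hm1]
      exact (setLIntegral_weight_le hFm hFi hc0 hcsq hε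
        ((measure_mono fun x (hx : t < F x) => ht.trans hx).trans hpos)).trans
        (hOS.layer_le hΦ hT_pos hT_mono hT_div hc₂ hup hη hF hpos hε ht)
    · rw [hρ, withDensity_apply _ hm2]
      exact (setLIntegral_weight_le hFm hFi hc0 hcsq hε
        ((measure_mono fun x (hx : t < -F x) => ht.trans hx).trans hneg)).trans
        (hOS.layer_le hΦ hT_pos hT_mono hT_div hc₂ hup hη hF.neg hneg hε ht)
  have hcake : ENNReal.ofReal (∫ x, F x ^ 2 * W x ∂μ) ≤
      ENNReal.ofReal (160 * c₂ * T (2 - p)) * (C * energy ν f) := by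
    calc ENNReal.ofReal (∫ x, F x ^ 2 * W x ∂μ)
        ≤ ∫⁻ x, ENNReal.ofReal (F x ^ 2 * W x) ∂μ := by
          rw [integral_eq_lintegral_of_nonneg_ae
            (Eventually.of_forall fun x => mul_nonneg (sq_nonneg _) (hW0 x))
            (Measurable.aestronglyMeasurable (by fun_prop))]
          exact ENNReal.ofReal_toReal_le
      _ = ∫⁻ x, ENNReal.ofReal (∫ t in (0 : ℝ)..|F x|, 2 * t) ∂ρ := by
          have hsq : ∀ x, ∫ t in (0 : ℝ)..|F x|, 2 * t = F x ^ 2 := fun x => by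
            rw [intervalIntegral.integral_const_mul, integral_id, sq_abs]
            ring
          have hm : Measurable fun x => ENNReal.ofReal (∫ t in (0 : ℝ)..|F x|, 2 * t) := by
            simp only [hsq]
            fun_prop
          rw [hρ, lintegral_withDensity_eq_lintegral_mul _ hWm.ennreal_ofReal hm]
          refine lintegral_congr fun x => ?_
          rw [Pi.mul_apply, ← ENNReal.ofReal_mul (hW0 x), hsq, mul_comm]
      _ = ∫⁻ t in Ioi (0 : ℝ), ρ {x | t < |F x|} * ENNReal.ofReal (2 * t) := by
          refine lintegral_comp_eq_lintegral_meas_lt_mul ρ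
            (Eventually.of_forall fun x => abs_nonneg (F x)) (by fun_prop)
            (fun t _ => Continuous.intervalIntegrable (by fun_prop) _ _) ?_
          filter_upwards [ae_restrict_mem measurableSet_Ioi] with t ht
          have : 0 < t := ht
          positivity
      _ ≤ ∫⁻ t in Ioi (0 : ℝ), (ENNReal.ofReal (40 * c₂ * T (2 - p)) * C) *
          (ENNReal.ofReal (2 * t) * (energy ν (fun x => η (F x / t)) +
            energy ν (fun x => η (-F x / t)))) := by
          refine setLIntegral_mono' measurableSet_Ioi fun t ht => ?_
          calc _ ≤ ENNReal.ofReal (40 * c₂ * T (2 - p)) * C *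
                (energy ν (fun x => η (F x / t)) + energy ν (fun x => η (-F x / t))) *
                ENNReal.ofReal (2 * t) := by gcongr; exact hlev t ht
            _ = _ := by ring
      _ ≤ (ENNReal.ofReal (40 * c₂ * T (2 - p)) * C) * (4 * energy ν f) := by
          have hEF' : energy ν F < ⊤ := by rw [hEF]; exact hE.lt_top
          rw [lintegral_const_mul _ (by
            have h1 := hη.measurable_energy_comp hF hEF'
            have h2 := hη.measurable_energy_comp hF.neg (by rw [energy_neg]; exact hEF')
            exact ((measurable_id.const_mul 2).ennreal_ofReal).mul (h1.add h2)), ← hEF]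
          gcongr
          exact hη.lintegral_energy_le hF hEF'
      _ = ENNReal.ofReal (160 * c₂ * T (2 - p)) * (C * energy ν f) := by
          have : 160 * c₂ * T (2 - p) = 40 * c₂ * T (2 - p) * 4 := by ring
          rw [this, ENNReal.ofReal_mul (by positivity) (q := 4), ENNReal.ofReal_ofNat]
          ring
  calc _ ≤ ENNReal.ofReal ((∫ x, F x ^ 2 * W x ∂μ) / T (2 - p)) := by
        apply ENNReal.ofReal_le_ofReal
        gcongr
    _ = ENNReal.ofReal (1 / T (2 - p)) * ENNReal.ofReal (∫ x, F x ^ 2 * W x ∂μ) := by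
        rw [← ENNReal.ofReal_mul (by positivity), one_div_mul_eq_div]
    _ ≤ ENNReal.ofReal (1 / T (2 - p)) *
          (ENNReal.ofReal (160 * c₂ * T (2 - p)) * (C * energy ν f)) := by gcongr
    _ = _ := by
        rw [← mul_assoc, ← ENNReal.ofReal_mul (by positivity), ← mul_assoc]
        congr 3
        field_simp

/-- This supplies the level condition of `luxemburgNorm_sq_le`, with `w t` a multiple of the
truncated energy. The constant `6` works because `6 · (7/32) · (81/100) > 1`. -/
theorem BecknerIneq.layer_le (hB : BecknerIneq T μ ν C)
    (hT_pos : ∀ x ∈ Ioc (0 : ℝ) 1, 0 < T x) {c₁ : ℝ} (hc₁ : 0 < c₁)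
    (hlow : ∀ x : ℝ, 2 ≤ x → c₁ * x * T (1 / Real.log (1 + x)) ≤ youngInv Φ x)
    {η : ℝ → ℝ} (hη : IsCutoff η) {F : EuclideanSpace ℝ (Fin n) → ℝ} (hF : ContDiff ℝ ∞ F)
    (hmed : μ {x | 0 < F x} ≤ 1 / 2) {t : ℝ} (ht : 0 < t) {r : ℝ}
    (hr : ENNReal.ofReal (6 / c₁) * C * energy ν (fun x => η (F x / t)) < ENNReal.ofReal r) :
    μ {x | t < F x} * Φ (1 / r) ≤ 1 := by
  have hFm : Measurable F := hF.continuous.measurable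
  have hr0 : 0 < r := ENNReal.ofReal_pos.mp (pos_of_gt hr)
  set A := {x | t < F x} with hA
  have hAm : MeasurableSet A := measurableSet_lt measurable_const hFm
  have hAle : μ A ≤ 1 / 2 := (measure_mono fun x (hx : t < F x) => ht.trans hx).trans hmed
  rcases eq_or_ne (μ A) 0 with h0 | h0
  · rw [h0, zero_mul]; exact zero_le_one
  have hs0 : 0 < μ.real A := ENNReal.toReal_pos h0 (measure_ne_top _ _)
  have hs2 : μ.real A ≤ 1 / 2 := by
    have := ENNReal.toReal_mono (by simp) hAle
    rw [measureReal_def]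
    simpa using this
  have hx2 : 2 ≤ 1 / μ.real A := by rw [le_div_iff₀ hs0]; linarith
  have hsupp : μ {x | η (F x / t) ≠ 0} ≤ 1 / 2 := by
    refine (measure_mono fun x hx => ?_).trans hmed
    by_contra h
    have hx' : F x ≤ 0 := not_lt.mp h
    exact hx (hη.eq_zero _ (div_nonpos_of_nonpos_of_nonneg hx' ht.le))
  have hcap := hB.level_le hT_pos (hη.contDiff_comp hF t) (hη.memLp hFm t 2)
    (fun x => hη.nonneg _) hsupp hAm hs0 hAle (by norm_num : (0 : ℝ) < 9 / 10)
    (fun x hx => hη.le_of_lt ht hx)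
  have hμA : μ A = ENNReal.ofReal (μ.real A) := by rw [ofReal_measureReal]
  set s := μ.real A with hs
  obtain ⟨hl0, hl1⟩ := one_div_log_mem hx2
  have hT := hT_pos _ ⟨hl0, hl1.le⟩
  have hlow' := hlow _ hx2
  set l := 1 / Real.log (1 + 1 / s) with hl
  have h1 : ENNReal.ofReal (s / (c₁ * T l)) < ENNReal.ofReal r := by
    refine lt_of_le_of_lt ?_ hr
    calc ENNReal.ofReal (s / (c₁ * T l))
        ≤ ENNReal.ofReal (6 / (c₁ * T l)) * ENNReal.ofReal (7 / 32 * ((9 / 10) ^ 2 * s)) := by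
          rw [← ENNReal.ofReal_mul (by positivity)]
          apply ENNReal.ofReal_le_ofReal
          rw [div_mul_eq_mul_div]
          gcongr
          linarith
      _ ≤ ENNReal.ofReal (6 / (c₁ * T l)) *
          (ENNReal.ofReal (T l) * (C * energy ν fun x => η (F x / t))) := by gcongr
      _ = _ := by
          rw [← mul_assoc, ← ENNReal.ofReal_mul (by positivity), ← mul_assoc]
          congr 3
          field_simp
  have h2 : s / (c₁ * T l) < r := (ENNReal.ofReal_lt_ofReal_iff'.mp h1).1
  have h3 : 1 / r < youngInv Φ (1 / s) := by
    refine lt_of_lt_of_le ?_ hlow'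
    rw [div_lt_iff₀ (by positivity)] at h2
    rw [div_lt_iff₀ hr0]
    have : c₁ * (1 / s) * T l * r = r * (c₁ * T l) / s := by ring
    rw [this, lt_div_iff₀ hs0]
    linarith
  have h4 := le_ofReal_of_lt_youngInv (by positivity) h3
  calc μ A * Φ (1 / r) ≤ ENNReal.ofReal s * ENNReal.ofReal (1 / s) := by rw [hμA]; gcongr
    _ = 1 := by
      rw [← ENNReal.ofReal_mul hs0.le, mul_one_div_cancel hs0.ne', ENNReal.ofReal_one]

/-- The positive and negative parts of `F` are summed separately and share one Maz'ya bound, giving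
`4 · 6/c₁`. Passing from median to mean by `(F - q)² ≤ 2F² + 2q²` and the hypothesis on `k` costs
`2(1+k)`. -/
theorem BecknerIneq.orliczSobolevIneq (hB : BecknerIneq T μ ν C) (hC : C ≠ 0) (hCt : C ≠ ⊤)
    (hT_pos : ∀ x ∈ Ioc (0 : ℝ) 1, 0 < T x) (hΦ : IsYoungFunction Φ) (hfin : ∀ z, Φ z < ⊤)
    {k : ℝ} (hk : 0 < k)
    (hΦk : ∀ f : EuclideanSpace ℝ (Fin n) → ℝ, Measurable f →
      MemOrlicz Φ μ (fun x => f x ^ 2) →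
      luxemburgNorm Φ μ (fun _ => (∫ y, f y ∂μ) ^ 2) ≤
        ENNReal.ofReal k * luxemburgNorm Φ μ (fun x => f x ^ 2))
    {c₁ : ℝ} (hc₁ : 0 < c₁)
    (hlow : ∀ x : ℝ, 2 ≤ x → c₁ * x * T (1 / Real.log (1 + x)) ≤ youngInv Φ x) :
    OrliczSobolevIneq Φ μ ν (ENNReal.ofReal (48 * (1 + k) / c₁) * C) := by
  intro f hf hfi
  rcases eq_or_ne (energy ν f) ⊤ with hE | hE
  · have : 0 < 48 * (1 + k) / c₁ := by positivity
    rw [hE, ENNReal.mul_top (mul_ne_zero (by simpa using this) hC)]; exact le_top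
  have hfm : Measurable f := hf.continuous.measurable
  obtain ⟨m, hm1, hm2⟩ := exists_median (μ := μ) hfm
  set F : EuclideanSpace ℝ (Fin n) → ℝ := fun x => f x - m with hFdef
  have hF : ContDiff ℝ ∞ F := hf.sub contDiff_const
  have hFm : Measurable F := hF.continuous.measurable
  have hEF : energy ν F = energy ν f := energy_sub_const f m
  have hEF' : energy ν F < ⊤ := by rw [hEF]; exact hE.lt_top
  have hEn : energy ν (fun x => -F x) < ⊤ := by rw [energy_neg]; exact hEF'
  have hpos : μ {x | 0 < F x} ≤ 1 / 2 := by simpa [F] using hm1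
  have hneg : μ {x | 0 < -F x} ≤ 1 / 2 := by simpa [F] using hm2
  obtain ⟨η, hη⟩ := exists_isCutoff
  set K := ENNReal.ofReal (6 / c₁) * C with hK
  have hpart : ∀ G : EuclideanSpace ℝ (Fin n) → ℝ, ContDiff ℝ ∞ G → energy ν G < ⊤ →
      μ {x | 0 < G x} ≤ 1 / 2 → luxemburgNorm Φ μ (fun x => (max (G x) 0) ^ 2) ≤
        ∫⁻ t in Ioi (0 : ℝ), ENNReal.ofReal (2 * t) *
          (K * energy ν (fun x => η (G x / t))) := by
    intro G hG hGE hmed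
    have hGm : Measurable G := hG.continuous.measurable
    refine luxemburgNorm_sq_le hΦ hfin (hGm.max measurable_const) (fun x => le_max_right _ _)
      ((hη.measurable_energy_comp hG hGE).const_mul K) fun t ht r hr => ?_
    have hset : {x | t < max (G x) 0} = {x | t < G x} := by
      ext x
      simp [ht.not_gt]
    rw [hset]
    exact hB.layer_le hT_pos hc₁ hlow hη hG hmed ht hr
  have hsq : luxemburgNorm Φ μ (fun x => F x ^ 2) ≤ 4 * K * energy ν f := by
    calc luxemburgNorm Φ μ (fun x => F x ^ 2)
        ≤ ENNReal.ofReal 1 * (luxemburgNorm Φ μ (fun x => (max (F x) 0) ^ 2) +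
            luxemburgNorm Φ μ (fun x => (max (-F x) 0) ^ 2)) := by
          have hm1 : Measurable fun x => max (F x) 0 ^ 2 := by fun_prop
          have hm2 : Measurable fun x => max (-F x) 0 ^ 2 := by fun_prop
          refine luxemburgNorm_le_of_abs_le hΦ hm1 hm2 one_pos fun x => ?_
          rw [abs_of_nonneg (sq_nonneg _), one_mul]
          rcases le_total (F x) 0 with h | h
          · rw [max_eq_right h, max_eq_left (by linarith)]; nlinarith
          · rw [max_eq_left h, max_eq_right (by linarith)]; nlinarith
      _ ≤ (∫⁻ t in Ioi (0 : ℝ), ENNReal.ofReal (2 * t) *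
            (K * energy ν (fun x => η (F x / t)))) +
          ∫⁻ t in Ioi (0 : ℝ), ENNReal.ofReal (2 * t) *
            (K * energy ν (fun x => η (-F x / t))) := by
          rw [ENNReal.ofReal_one, one_mul]
          exact add_le_add (hpart F hF hEF' hpos) (hpart (fun x => -F x) hF.neg hEn hneg)
      _ = K * ∫⁻ t in Ioi (0 : ℝ), ENNReal.ofReal (2 * t) *
            (energy ν (fun x => η (F x / t)) + energy ν (fun x => η (-F x / t))) := by
          have h1 := hη.measurable_energy_comp hF hEF'
          have h2 := hη.measurable_energy_comp hF.neg hEn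
          have h3 : Measurable fun t : ℝ => ENNReal.ofReal (2 * t) :=
            (measurable_id.const_mul 2).ennreal_ofReal
          have h4 : Measurable fun t : ℝ => ENNReal.ofReal (2 * t) *
              (K * energy ν (fun x => η (F x / t))) := h3.mul (h1.const_mul K)
          have h5 : Measurable fun t : ℝ => ENNReal.ofReal (2 * t) *
              (energy ν (fun x => η (F x / t)) + energy ν (fun x => η (-F x / t))) :=
            h3.mul (h1.add h2)
          rw [← lintegral_add_left h4, ← lintegral_const_mul _ h5]
          refine lintegral_congr fun t => ?_
          ring
      _ ≤ K * (4 * energy ν F) := by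
          gcongr
          exact hη.lintegral_energy_le hF hEF'
      _ = 4 * K * energy ν f := by rw [hEF]; ring
  -- The hypothesis on `k` speaks only of squares in the Orlicz space. Membership follows from the
  -- norm bound just proved, which is finite because `C` and the energy are.
  have hmem : MemOrlicz Φ μ (fun x => F x ^ 2) := by
    refine ⟨hFm.pow_const 2, ?_⟩
    have hlt : luxemburgNorm Φ μ (fun x => F x ^ 2) < ⊤ := hsq.trans_lt
      (ENNReal.mul_lt_top (ENNReal.mul_lt_top (by simp)
        (ENNReal.mul_lt_top ENNReal.ofReal_lt_top hCt.lt_top)) hE.lt_top)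
    set q := (luxemburgNorm Φ μ (fun x => F x ^ 2)).toReal + 1 with hq
    have hq0 : 0 < q := by positivity
    have h1 := lintegral_le_one_of_luxemburgNorm_lt hΦ (μ := μ) (f := fun x => F x ^ 2) (r := q)
      (by rw [ENNReal.lt_ofReal_iff_toReal_lt hlt.ne]; linarith)
    refine ⟨1 / q, by positivity, lt_of_le_of_lt ?_ ENNReal.one_lt_top⟩
    simpa only [one_div_mul_eq_div] using h1
  have hmean : ∫ x, f x ∂μ = (∫ x, F x ∂μ) + m := by
    simp only [hFdef]
    rw [integral_sub hfi (integrable_const m)]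
    simp
  calc luxemburgNorm Φ μ (fun x => (f x - ∫ y, f y ∂μ) ^ 2)
      ≤ ENNReal.ofReal 2 * (luxemburgNorm Φ μ (fun x => F x ^ 2) +
          luxemburgNorm Φ μ (fun _ => (∫ y, F y ∂μ) ^ 2)) := by
        refine luxemburgNorm_le_of_abs_le hΦ (hFm.pow_const 2) measurable_const two_pos
          fun x => ?_
        rw [abs_of_nonneg (sq_nonneg _), hmean]
        have : f x - ((∫ x, F x ∂μ) + m) = F x - ∫ x, F x ∂μ := by simp only [hFdef]; ring
        rw [this]
        nlinarith [sq_nonneg (F x + ∫ x, F x ∂μ)]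
    _ ≤ ENNReal.ofReal 2 * (luxemburgNorm Φ μ (fun x => F x ^ 2) +
          ENNReal.ofReal k * luxemburgNorm Φ μ (fun x => F x ^ 2)) := by
        gcongr
        exact hΦk F hFm hmem
    _ = ENNReal.ofReal (2 * (1 + k)) * luxemburgNorm Φ μ (fun x => F x ^ 2) := by
        rw [ENNReal.ofReal_mul two_pos.le, ENNReal.ofReal_add zero_le_one hk.le,
          ENNReal.ofReal_one]
        ring
    _ ≤ ENNReal.ofReal (2 * (1 + k)) * (4 * K * energy ν f) := by gcongr
    _ = ENNReal.ofReal (48 * (1 + k) / c₁) * C * energy ν f := by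
        have : 48 * (1 + k) / c₁ = 2 * (1 + k) * 4 * (6 / c₁) := by ring
        rw [this, ENNReal.ofReal_mul (p := 2 * (1 + k) * 4) (by positivity),
          ENNReal.ofReal_mul (p := 2 * (1 + k)) (by positivity), ENNReal.ofReal_ofNat, hK]
        ring

/-! ### Optimal constants and the conclusion. -/

/-- Comparison of the optimal constants of two families of inequalities, from a comparison of
their non-degenerate constants. -/
theorem sInf_le_mul_sInf {P Q : ℝ≥0∞ → Prop} {K : ℝ≥0∞} (hK0 : K ≠ 0) (hK : K ≠ ⊤)
    (hP : ∀ C C', P C → C ≤ C' → P C') (h : ∀ C, C ≠ 0 → C ≠ ⊤ → P C → Q (K * C)) :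
    sInf {C | Q C} ≤ K * sInf {C | P C} := by
  rw [mul_comm, ← ENNReal.div_le_iff_le_mul (Or.inl hK0) (Or.inl hK)]
  refine le_sInf fun C hC => ?_
  rw [ENNReal.div_le_iff_le_mul (Or.inl hK0) (Or.inl hK)]
  rcases eq_or_ne C ⊤ with rfl | hCt
  · rw [ENNReal.top_mul hK0]; exact le_top
  rw [← ENNReal.div_le_iff_le_mul (Or.inl hK0) (Or.inl hK)]
  -- `C = 0` is excluded from `h`, since `0 · ∞ = 0` would constrain functions of infinite energy.
  -- Every `C' > C` is nonzero and still satisfies `P`, so approaching `C` from above suffices.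
  refine le_of_forall_gt_imp_ge_of_dense fun C' hC' => ?_
  rcases eq_or_ne C' ⊤ with rfl | hCt'
  · exact le_top
  rw [ENNReal.div_le_iff_le_mul (Or.inl hK0) (Or.inl hK), mul_comm]
  exact sInf_le (h C' (ne_bot_of_gt hC') hCt' (hP C C' hC hC'.le))

end OrliczSobolev

theorem mainTheorem2 (n : ℕ) (μ ν : Measure (EuclideanSpace ℝ (Fin n)))
    [IsProbabilityMeasure μ] (hμ : μ ≪ volume) (hν : ν ≪ volume)
    (T : ℝ → ℝ) (hT_nonneg : ∀ x ∈ Icc (0 : ℝ) 1, 0 ≤ T x)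
    (hT_pos : ∀ x ∈ Ioc (0 : ℝ) 1, 0 < T x)
    (hT_mono : MonotoneOn T (Icc 0 1))
    (hT_div : AntitoneOn (fun x => T x / x) (Ioc 0 1))
    (Φ : ℝ → ℝ≥0∞) (hΦ : OrliczSobolev.IsYoungFunction Φ)
    (k : ℝ) (hk : 0 < k)
    (hΦk : ∀ f : EuclideanSpace ℝ (Fin n) → ℝ, Measurable f →
      OrliczSobolev.MemOrlicz Φ μ (fun x => f x ^ 2) →
      OrliczSobolev.luxemburgNorm Φ μ (fun _ => (∫ y, f y ∂μ) ^ 2) ≤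
        ENNReal.ofReal k * OrliczSobolev.luxemburgNorm Φ μ (fun x => f x ^ 2))
    (c₁ c₂ : ℝ) (hc₁ : 0 < c₁) (hc₂ : 0 < c₂)
    (hΦT : ∀ x : ℝ, 2 < x →
      c₁ * x * T (1 / Real.log (1 + x)) ≤ OrliczSobolev.youngInv Φ x ∧
      OrliczSobolev.youngInv Φ x ≤ c₂ * x * T (1 / Real.log (1 + x))) :
    ((∃ C : ℝ≥0∞, C < ⊤ ∧ OrliczSobolev.OrliczSobolevIneq Φ μ ν C) ↔
      (∃ C : ℝ≥0∞, C < ⊤ ∧ OrliczSobolev.BecknerIneq T μ ν C)) ∧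
    ENNReal.ofReal (c₁ / (48 * (1 + k))) * OrliczSobolev.orliczSobolevConst Φ μ ν ≤
      OrliczSobolev.becknerConst T μ ν ∧
    OrliczSobolev.becknerConst T μ ν ≤
      ENNReal.ofReal (160 * c₂) * OrliczSobolev.orliczSobolevConst Φ μ ν := by
  have hfin := OrliczSobolev.lt_top_of_le_youngInv hT_pos hT_div hΦ hc₁ fun x hx => (hΦT x hx).1
  have hlow : ∀ x : ℝ, 2 ≤ x →
      c₁ * x * T (1 / Real.log (1 + x)) ≤ OrliczSobolev.youngInv Φ x := fun x hx =>
    OrliczSobolev.le_youngInv_of_lt hT_div hΦ hc₁ (fun x hx => (hΦT x hx).1) hx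
  have hup : ∀ x : ℝ, 2 ≤ x →
      OrliczSobolev.youngInv Φ x ≤ c₂ * x * T (1 / Real.log (1 + x)) := fun x hx =>
    OrliczSobolev.youngInv_le_of_lt hT_mono hΦ hc₂ (fun x hx => (hΦT x hx).2) hx
  have hK1 : 0 < 160 * c₂ := by positivity
  have hK2 : 0 < 48 * (1 + k) / c₁ := by positivity
  have h1 : OrliczSobolev.becknerConst T μ ν ≤
      ENNReal.ofReal (160 * c₂) * OrliczSobolev.orliczSobolevConst Φ μ ν :=
    OrliczSobolev.sInf_le_mul_sInf (by simpa using hK1) ENNReal.ofReal_ne_top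
      (fun _ _ h hC => h.mono hC) fun C hC _ h =>
      h.becknerIneq hC hΦ hT_pos hT_mono hT_div hc₂ hup
  have h2 : OrliczSobolev.orliczSobolevConst Φ μ ν ≤
      ENNReal.ofReal (48 * (1 + k) / c₁) * OrliczSobolev.becknerConst T μ ν :=
    OrliczSobolev.sInf_le_mul_sInf (by simpa using hK2) ENNReal.ofReal_ne_top
      (fun _ _ h hC => h.mono hC) fun C hC hCt h =>
      h.orliczSobolevIneq hC hCt hT_pos hΦ hfin hk hΦk hc₁ hlow
  refine ⟨⟨fun ⟨C, hC, h⟩ => ?_, fun ⟨C, hC, h⟩ => ?_⟩, ?_, h1⟩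
  · have h3 : OrliczSobolev.becknerConst T μ ν < ⊤ :=
      h1.trans_lt (ENNReal.mul_lt_top ENNReal.ofReal_lt_top ((sInf_le h).trans_lt hC))
    obtain ⟨C', h4, h5⟩ := sInf_lt_iff.mp h3
    exact ⟨C', h5, h4⟩
  · have h3 : OrliczSobolev.orliczSobolevConst Φ μ ν < ⊤ :=
      h2.trans_lt (ENNReal.mul_lt_top ENNReal.ofReal_lt_top ((sInf_le h).trans_lt hC))
    obtain ⟨C', h4, h5⟩ := sInf_lt_iff.mp h3
    exact ⟨C', h5, h4⟩
  · calc _ ≤ ENNReal.ofReal (c₁ / (48 * (1 + k))) *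
          (ENNReal.ofReal (48 * (1 + k) / c₁) * OrliczSobolev.becknerConst T μ ν) := by gcongr
      _ = OrliczSobolev.becknerConst T μ ν := by
        rw [← mul_assoc, ← ENNReal.ofReal_mul (by positivity), div_mul_div_cancel₀ (by positivity),
          div_self hc₁.ne', ENNReal.ofReal_one, one_mul]
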